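/- Let $d,M,N,\beta\ge 1$ be integers with $\beta\ge d+1$ even, and let $\vec t_1,\dots,\vec t_M\in[0,1)^d$ be pairwise distinct nodes, $\Omega=\{\vec t_1,\dots,\vec t_M\}$. Put $\|\vec x\|_{\mathbb T}:=\min_{\vec r\in\mathbb Z^d}\|\vec x+\vec r\|_\infty$ for $\vec x\in\mathbb R^d$. Assume that $\Omega=\bigcup_{l=1}^L\Lambda_l$ is a clustered node configuration, that is, each cluster $\Lambda_l$ is contained in a cube of side length $1/N$ in the torus $\mathbb R^d/\mathbb Z^d$, and the normalized cluster separation $$\rho:=N\min_{1\le l<l'\le L}\ \min_{\vec t\in\Lambda_l,\ \vec t'\in\Lambda_{l'}}\|\vec t-\vec t'\|_{\mathbb T}$$ satisfies $\rho>1$ (with $\rho=\infty$ if $L=1$). Let $\lambda:=\max_l|\Lambda_l|$ be the size of the biggest cluster and let $$\mathcal C:=\max_{j=1,\dots,M}\ \prod_{\vec t'\in\Omega:\ 0<\|\vec t_j-\vec t'\|_{\mathbb T}\le 1/N}\frac1{N\|\vec t_j-\vec t'\|_{\mathbb T}}$$ be the cluster complexity, where an empty product equals $1$. Assume $N>2\beta^2\lambda$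 and $$\rho\ \ge\ \lambda\beta\left(\beta^{1/2}\,2^d(2^d-1)\,\lambda^\lambda\,\zeta(\beta-d+1)\,\mathcal C\right)^{1/\beta},$$ where $\zeta$ is the Riemann zeta function. Let $\mathbf A\in\mathbb C^{M\times N^d}$ be the Vandermonde matrix with entries $\mathrm e^{2\pi\mathrm i\,\vec\alpha\cdot\vec t_j}$, where $j=1,\dots,M$ and $\vec\alpha\in\{0,1,\dots,N-1\}^d$. Then its smallest singular value $\sigma_{\min}(\mathbf A):=\min_{\vec v\in\mathbb C^M,\ \|\vec v\|_2=1}\|\mathbf A^*\vec v\|_2$ satisfies $$\sigma_{\min}(\mathbf A)\ \ge\ \left(1.5\cdot\beta^{d/4}\,\lambda^{\lambda+d/2-1/2}\right)^{-1}\frac{N^{d/2}}{\mathcal C}.$$ -/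

import Mathlib

open scoped ENNReal

noncomputable section

/-- The wrap-around max-norm on `ℝ^d`: the distance of `x` to `ℤ^d` in the max-norm
(the norm of `Fin d → ℝ` is the max-norm). -/
def wrapNorm {d : ℕ} (x : Fin d → ℝ) : ℝ :=
  ⨅ r : Fin d → ℤ, ‖fun i => x i + (r i : ℝ)‖

/-- The multivariate Vandermonde matrix `(z_j ^ α)` with nodes `z_j = exp(2πi t_j)`; the
columns are indexed by the `α ∈ ℕ₀^d` with all components at most `n = N - 1`. -/
def vandermondeMatrix {d M : ℕ} (N : ℕ) (t : Fin M → Fin d → ℝ) :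
    Matrix (Fin M) (Fin d → Fin N) ℂ :=
  Matrix.of fun j α =>
    ∏ i : Fin d, Complex.exp (2 * Real.pi * Complex.I * (t j i : ℂ)) ^ (α i : ℕ)

/-- The smallest singular value: the minimum of `‖A* v‖₂` over the unit vectors `v`. -/
def sigmaMin {m n : Type*} [Fintype m] [Fintype n] (A : Matrix m n ℂ) : ℝ :=
  ⨅ v : {v : EuclideanSpace ℂ m // ‖v‖ = 1},
    ‖(WithLp.toLp 2 (A.conjTranspose.mulVec (WithLp.ofLp v.1)) : EuclideanSpace ℂ n)‖

/-- A finite set of points is a cluster if, on the torus `ℝ^d / ℤ^d`, it is contained in a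
cube of side length `1 / N`. -/
def IsCluster {d : ℕ} (N : ℕ) (S : Finset (Fin d → ℝ)) : Prop :=
  ∃ a : Fin d → ℝ, ∀ x ∈ S, ∃ r : Fin d → ℤ,
    ∀ i, a i ≤ x i + (r i : ℝ) ∧ x i + (r i : ℝ) ≤ a i + 1 / (N : ℝ)

/-- The wrap-around distance of two finite sets (`∞` if one of them is empty). -/
def clusterDist {d : ℕ} (S T : Finset (Fin d → ℝ)) : ℝ≥0∞ :=
  ⨅ x ∈ S, ⨅ y ∈ T, ENNReal.ofReal (wrapNorm (x - y))

/-- The normalized minimal cluster separation `ρ` (`∞` if there is only one cluster). -/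
def clusterSeparation {d L : ℕ} (N : ℕ) (Λ : Fin L → Finset (Fin d → ℝ)) : ℝ≥0∞ :=
  (N : ℝ≥0∞) * ⨅ (l : Fin L) (l' : Fin L) (_ : l < l'), clusterDist (Λ l) (Λ l')

/-- The cardinality of the biggest cluster. -/
def biggestClusterSize {d L : ℕ} (Λ : Fin L → Finset (Fin d → ℝ)) : ℕ :=
  Finset.univ.sup fun l => (Λ l).card

/-- The set of the `M` distinct nodes `t_1, …, t_M ∈ [0,1)^d` is a clustered node
configuration with clusters `Λ_1, …, Λ_L`. -/
structure IsClusteredConfiguration {d M L : ℕ} (N : ℕ) (t : Fin M → Fin d → ℝ)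
    (Λ : Fin L → Finset (Fin d → ℝ)) : Prop where
  mem_Ico : ∀ j i, t j i ∈ Set.Ico (0 : ℝ) 1
  injective : Function.Injective t
  range_eq : Set.range t = ⋃ l, (Λ l : Set (Fin d → ℝ))
  isCluster : ∀ l, IsCluster N (Λ l)
  one_lt_separation : 1 < clusterSeparation N Λ

open scoped Classical in
/-- The cluster complexity: the maximum over `j` of the product of `1 / (N ‖t_j - t'‖)` over
all nodes `t'` with `0 < ‖t_j - t'‖ ≤ 1 / N`, in the wrap-around norm. -/
def clusterComplexity {d M : ℕ} (N : ℕ) (t : Fin M → Fin d → ℝ) : ℝ :=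
  ⨆ j : Fin M,
    ∏ x ∈ (Finset.univ.image t).filter
        (fun x => 0 < wrapNorm (t j - x) ∧ wrapNorm (t j - x) ≤ 1 / (N : ℝ)),
      1 / ((N : ℝ) * wrapNorm (t j - x))

end

/-! The proof is by duality. For each node `t k` it builds a trigonometric polynomial `P_k(x) = ∏ i,
p k i (exp(2πi x_i))`, of degree below `N` in every variable, with `P_k(t_j)` close to `δ_jk`. For a
unit vector `v`, pairing `A* v` with the combined coefficient vector `c = ∑ k, v k * coeff(P_k)`
gives `∑ conj(v j) v k P_k(t_j) = 1 + error`. Cauchy–Schwarz then bounds `‖A* v‖` below by `(1 - ε)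
/ ‖c‖`.

`P_k` is a Lagrange factor, which vanishes at the other nodes of the cluster, times a localization
kernel `D_{m₁} D_{m₂}^β` in each variable, which is small at the other clusters
(`exists_isLocalLagrange`). The Lagrange factor costs at most `λ^(λ-1) C`. Both the error matrix and
the Gram matrix of the coefficient vectors decay like the `β`-th power of the inverse distance
between clusters. The Schur test `norm_sum_sum_le_of_symm` and the packing bound
`sum_div_wrapNorm_pow_le` control them, and the packing bound is the source of `2^d (2^d - 1) ζ(β -
d + 1)`. Gram entries come from Parseval at the `N`-th roots of unity
(`norm_sum_coeff_mul_conj_le`).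

The degree budget splits as `m₁ ≈ N/(2λ)`, `m₂ ≈ N/(λβ)`, and degree about `3N/(8λ)` for each
Lagrange factor. This fits for `λ ≥ 2`. If `λ = 1`, a smaller `m₂` is forced, and `c` is compared
entrywise with `A* v`, without the Gram matrix. -/

section

open Polynomial Finset ComplexConjugate

/-! ### Characters of the circle and the distance to the integers -/

/-- The character `x ↦ exp(2πix)` of the torus. -/
noncomputable def torusChar (x : ℝ) : ℂ := Complex.exp (2 * Real.pi * Complex.I * x)

/-- The distance of a real number to the integers. -/
noncomputable def distInt (x : ℝ) : ℝ := |x - round x|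

lemma norm_torusChar (x : ℝ) : ‖torusChar x‖ = 1 := by
  rw [torusChar, Complex.norm_exp]
  simp

lemma torusChar_zero : torusChar 0 = 1 := by simp [torusChar]

lemma torusChar_add (x y : ℝ) : torusChar (x + y) = torusChar x * torusChar y := by
  rw [torusChar, torusChar, torusChar, ← Complex.exp_add]
  push_cast
  ring_nf

lemma torusChar_neg (x : ℝ) : torusChar (-x) = conj (torusChar x) := by
  rw [torusChar, torusChar, ← Complex.exp_conj]
  simp [Complex.conj_ofNat]

lemma torusChar_sub (x y : ℝ) : torusChar (x - y) = torusChar x * conj (torusChar y) := by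
  rw [sub_eq_add_neg, torusChar_add, torusChar_neg]

lemma torusChar_natCast_mul (n : ℕ) (x : ℝ) : torusChar (n * x) = torusChar x ^ n := by
  rw [torusChar, torusChar, ← Complex.exp_nat_mul]
  push_cast
  ring_nf

lemma torusChar_intCast (n : ℤ) : torusChar n = 1 := by
  rw [torusChar, Complex.exp_eq_one_iff]
  exact ⟨n, by push_cast; ring⟩

lemma torusChar_sub_round (x : ℝ) : torusChar (x - round x) = torusChar x := by
  rw [torusChar_sub, torusChar_intCast]
  simp

lemma norm_one_sub_torusChar (x : ℝ) : ‖1 - torusChar x‖ = 2 * |Real.sin (Real.pi * x)| := by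
  have h : torusChar x = Complex.exp (Complex.I * ((2 * Real.pi * x : ℝ) : ℂ)) := by
    rw [torusChar]
    push_cast
    ring_nf
  rw [norm_sub_rev, h, Complex.norm_exp_I_mul_ofReal_sub_one, norm_mul, Real.norm_eq_abs,
    Real.norm_eq_abs]
  simp only [Nat.abs_ofNat]
  ring_nf

lemma distInt_nonneg (x : ℝ) : 0 ≤ distInt x := abs_nonneg _

lemma distInt_eq_norm (x : ℝ) : distInt x = ‖(x : UnitAddCircle)‖ := UnitAddCircle.norm_eq.symm

lemma distInt_sub_comm (x y : ℝ) : distInt (x - y) = distInt (y - x) := by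
  rw [distInt_eq_norm, distInt_eq_norm, AddCircle.coe_sub, AddCircle.coe_sub, norm_sub_rev]

lemma distInt_sub_le (x y z : ℝ) : distInt (x - z) ≤ distInt (x - y) + distInt (y - z) := by
  simp only [distInt_eq_norm, AddCircle.coe_sub]
  exact norm_sub_le_norm_sub_add_norm_sub _ _ _

lemma distInt_le_abs_add_int (x : ℝ) (n : ℤ) : distInt x ≤ |x + n| := by
  have := round_le x (-n)
  simpa [distInt] using this

/-- Jordan's inequality `sin θ ≥ 2θ/π`, applied to the representative of `x` in `[-1/2, 1/2]`. -/
lemma four_mul_distInt_le (x : ℝ) : 4 * distInt x ≤ ‖1 - torusChar x‖ := by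
  rw [← torusChar_sub_round, norm_one_sub_torusChar]
  have h1 : |x - round x| ≤ 1 / 2 := abs_sub_round x
  have h2 : |Real.pi * (x - round x)| ≤ Real.pi / 2 := by
    rw [abs_mul, abs_of_pos Real.pi_pos]
    nlinarith [Real.pi_pos]
  have h3 := Real.mul_abs_le_abs_sin h2
  rw [abs_mul, abs_of_pos Real.pi_pos] at h3
  have h4 : 2 / Real.pi * (Real.pi * |x - round x|) = 2 * distInt x := by
    rw [distInt]
    field_simp
  linarith

/-- On `[0, π/4]` the sine lies above its chord, and `sin (π/4) = √2/2 ≥ 2/3`. The improvement of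
Jordan's constant `4` to `16/3` lets the Lagrange factors have degree `3N/(8λ)` instead of `N/(2λ)`.
-/
lemma norm_one_sub_torusChar_ge_of_abs_le_quarter {x : ℝ} (hx : |x| ≤ 1 / 4) :
    16 / 3 * |x| ≤ ‖1 - torusChar x‖ := by
  rw [norm_one_sub_torusChar]
  wlog h0 : 0 ≤ x generalizing x
  · have := this (x := -x) (by rwa [abs_neg]) (by linarith)
    simpa [abs_neg] using this
  rw [abs_of_nonneg h0] at hx ⊢
  have hpi := Real.pi_pos
  have hc := strictConcaveOn_sin_Icc.concaveOn.2 (Set.left_mem_Icc.2 hpi.le)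
    (Set.mem_Icc.2 ⟨by positivity, by linarith⟩ : Real.pi / 4 ∈ Set.Icc 0 Real.pi)
    (by linarith : 0 ≤ 1 - 4 * x) (by linarith : 0 ≤ 4 * x) (by ring)
  simp only [smul_eq_mul, Real.sin_zero, mul_zero, zero_add, Real.sin_pi_div_four] at hc
  have h1 : 4 * x * (Real.pi / 4) = Real.pi * x := by ring
  rw [h1] at hc
  have h2 : (4 / 3 : ℝ) ≤ √2 := by
    apply Real.le_sqrt_of_sq_le
    norm_num
  have := le_abs_self (Real.sin (Real.pi * x))
  nlinarith

/-! ### Dirichlet kernels -/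

/-- The normalized Dirichlet kernel `m⁻¹ ∑_{l < m} exp(2πily)`. -/
noncomputable def dirichletKernel (m : ℕ) (y : ℝ) : ℂ :=
  (m : ℂ)⁻¹ * ∑ l ∈ range m, torusChar y ^ l

/-- The polynomial `m⁻¹ ∑_{l < m} (wX)^l`. -/
noncomputable def dirichletPoly (m : ℕ) (w : ℂ) : ℂ[X] :=
  C (m : ℂ)⁻¹ * ∑ l ∈ range m, (C w * X) ^ l

lemma eval_dirichletPoly (m : ℕ) (s x : ℝ) :
    (dirichletPoly m (torusChar (-s))).eval (torusChar x) = dirichletKernel m (x - s) := by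
  simp only [dirichletPoly, dirichletKernel, eval_mul, eval_C, eval_finsetSum, eval_pow, eval_X]
  congr 1
  refine sum_congr rfl fun l _ => ?_
  rw [sub_eq_add_neg, torusChar_add, mul_comm]

lemma coeff_dirichletPoly (m : ℕ) (w : ℂ) (a : ℕ) :
    (dirichletPoly m w).coeff a = if a < m then (m : ℂ)⁻¹ * w ^ a else 0 := by
  simp only [dirichletPoly, coeff_C_mul, finsetSum_coeff, mul_pow, ← C_pow, coeff_X_pow]
  simp

lemma natDegree_dirichletPoly_le (m : ℕ) (w : ℂ) : (dirichletPoly m w).natDegree ≤ m - 1 := by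
  rw [natDegree_le_iff_coeff_eq_zero]
  intro a ha
  rw [coeff_dirichletPoly, if_neg (by omega)]

lemma dirichletKernel_zero {m : ℕ} (hm : m ≠ 0) : dirichletKernel m 0 = 1 := by
  have : (m : ℂ) ≠ 0 := by exact_mod_cast hm
  simp [dirichletKernel, torusChar_zero, this]

lemma norm_dirichletKernel_le_one (m : ℕ) (y : ℝ) : ‖dirichletKernel m y‖ ≤ 1 := by
  rw [dirichletKernel, norm_mul, norm_inv, Complex.norm_natCast]
  have h : ‖∑ l ∈ range m, torusChar y ^ l‖ ≤ m := by
    refine (norm_sum_le _ _).trans ?_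
    simp [norm_torusChar]
  calc (m : ℝ)⁻¹ * _ ≤ (m : ℝ)⁻¹ * m := by gcongr
    _ ≤ 1 := inv_mul_le_one

lemma norm_dirichletKernel_mul_le (m : ℕ) (y : ℝ) :
    ‖dirichletKernel m y‖ * (2 * m * distInt y) ≤ 1 := by
  rcases Nat.eq_zero_or_pos m with rfl | hm
  · simp
  have hm' : (0 : ℝ) < m := by exact_mod_cast hm
  rw [dirichletKernel, norm_mul, norm_inv, Complex.norm_natCast]
  set S := ∑ l ∈ range m, torusChar y ^ l
  have h1 : S * (torusChar y - 1) = torusChar y ^ m - 1 := geom_sum_mul _ _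
  have h2 : ‖S‖ * ‖1 - torusChar y‖ ≤ 2 := by
    rw [norm_sub_rev, ← norm_mul, h1]
    refine (norm_sub_le _ _).trans ?_
    simp only [norm_pow, norm_torusChar, one_pow, norm_one]
    norm_num
  have h3 : ‖S‖ * (4 * distInt y) ≤ 2 :=
    (mul_le_mul_of_nonneg_left (four_mul_distInt_le y) (norm_nonneg _)).trans h2
  calc (m : ℝ)⁻¹ * ‖S‖ * (2 * m * distInt y) = ‖S‖ * (4 * distInt y) / 2 := by
        field_simp
        ring
    _ ≤ 1 := by linarith

lemma norm_dirichletKernel_le_inv {m : ℕ} {y a : ℝ} (ha : 0 < a)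
    (h : a ≤ 2 * m * distInt y) : ‖dirichletKernel m y‖ ≤ a⁻¹ := by
  rw [← one_div, le_div_iff₀ ha]
  exact (mul_le_mul_of_nonneg_left h (norm_nonneg _)).trans (norm_dirichletKernel_mul_le m y)

/-- By the triangle inequality `x` has distance at least half of `distInt (s - s')` from one of the
two centres. The kernel there decays, and the other is at most `1`. -/
lemma norm_dirichletKernel_mul_dirichletKernel_le {m : ℕ} {x s s' a : ℝ} (ha : 0 < a)
    (h : a ≤ m * distInt (s - s')) :
    ‖dirichletKernel m (x - s)‖ * ‖dirichletKernel m (x - s')‖ ≤ a⁻¹ := by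
  have h1 := distInt_sub_le s x s'
  rw [distInt_sub_comm s x] at h1
  have hm : (0 : ℝ) ≤ m := Nat.cast_nonneg m
  rcases le_total (distInt (x - s)) (distInt (x - s')) with h2 | h2
  · have := norm_dirichletKernel_le_inv (m := m) (y := x - s') ha
      (h.trans (by nlinarith))
    calc _ ≤ 1 * a⁻¹ := by
          gcongr
          exact norm_dirichletKernel_le_one _ _
      _ = a⁻¹ := one_mul _
  · have := norm_dirichletKernel_le_inv (m := m) (y := x - s) ha
      (h.trans (by nlinarith))
    calc _ ≤ a⁻¹ * 1 := by
          gcongr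
          exact norm_dirichletKernel_le_one _ _
      _ = a⁻¹ := mul_one _

/-! ### Discrete Parseval identity -/

/-- The orthogonality relations of the characters at the `N`-th roots of unity. -/
lemma sum_torusChar_div {N : ℕ} {a b : ℕ} (ha : a < N) (hb : b < N) :
    ∑ x ∈ range N, torusChar (x / N) ^ a * conj (torusChar (x / N) ^ b) =
      if a = b then (N : ℂ) else 0 := by
  have hN : (N : ℝ) ≠ 0 := by
    have : N ≠ 0 := by omega
    exact_mod_cast this
  have h1 (x : ℕ) : torusChar (x / N) ^ a * conj (torusChar (x / N) ^ b) =
      torusChar (((a : ℝ) - b) / N) ^ x := by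
    rw [← torusChar_natCast_mul, ← torusChar_natCast_mul, ← torusChar_natCast_mul,
      ← torusChar_sub]
    congr 1
    ring
  simp only [h1]
  split_ifs with hab
  · simp [hab, torusChar_zero]
  · set z := torusChar (((a : ℝ) - b) / N)
    have hz : z ^ N = 1 := by
      rw [← torusChar_natCast_mul, mul_div_cancel₀ _ hN]
      exact_mod_cast torusChar_intCast ((a : ℤ) - b)
    have hz1 : z ≠ 1 := by
      intro h
      simp only [z, torusChar, Complex.exp_eq_one_iff] at h
      obtain ⟨n, hn⟩ := h
      have h2 : (((a : ℝ) - b) / N : ℝ) = n := by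
        have hpi : (2 * Real.pi * Complex.I : ℂ) ≠ 0 := by
          simp [Real.pi_ne_zero]
        rw [mul_comm (n : ℂ)] at hn
        exact_mod_cast mul_left_cancel₀ hpi hn
      rw [div_eq_iff hN] at h2
      have h3 : (a : ℤ) - b = n * N := by exact_mod_cast h2
      -- A multiple of `N` of absolute value below `N` is zero, which contradicts `a ≠ b`.
      have h4 : |(a : ℤ) - b| < N := by rw [abs_lt]; omega
      have h5 : n = 0 := by
        by_contra hn0
        have : 1 ≤ |n| := Int.one_le_abs hn0
        rw [h3, abs_mul, Nat.abs_cast] at h4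
        nlinarith
      subst h5
      omega
    have := geom_sum_mul z N
    rw [hz, sub_self] at this
    exact (mul_eq_zero.1 this).resolve_right (sub_ne_zero.2 hz1)

lemma sum_eval_mul_conj_eval {N : ℕ} {p q : ℂ[X]} (hp : p.natDegree < N) (hq : q.natDegree < N) :
    ∑ x ∈ range N, p.eval (torusChar (x / N)) * conj (q.eval (torusChar (x / N))) =
      N * ∑ a ∈ range N, p.coeff a * conj (q.coeff a) := by
  have h (x : ℕ) : p.eval (torusChar (x / N)) * conj (q.eval (torusChar (x / N))) =
      ∑ a ∈ range N, ∑ b ∈ range N, p.coeff a * conj (q.coeff b) *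
        (torusChar (x / N) ^ a * conj (torusChar (x / N) ^ b)) := by
    rw [eval_eq_sum_range' hp, eval_eq_sum_range' hq, map_sum, sum_mul_sum]
    refine sum_congr rfl fun a _ => sum_congr rfl fun b _ => ?_
    rw [map_mul]
    ring
  simp only [h]
  rw [sum_comm, mul_sum]
  refine sum_congr rfl fun a ha => ?_
  rw [sum_comm]
  calc _ = ∑ b ∈ range N, p.coeff a * conj (q.coeff b) * (if a = b then (N : ℂ) else 0) := by
        refine sum_congr rfl fun b hb => ?_
        rw [← mul_sum, sum_torusChar_div (mem_range.1 ha) (mem_range.1 hb)]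
    _ = _ := by
        simp only [mul_ite, mul_zero, sum_ite_eq, if_pos ha]
        ring

lemma sum_norm_dirichletKernel_sq {N m : ℕ} (hm : 0 < m) (hmN : m ≤ N) (s : ℝ) :
    ∑ x ∈ range N, ‖dirichletKernel m (x / N - s)‖ ^ 2 = N / m := by
  have hd : (dirichletPoly m (torusChar (-s))).natDegree < N :=
    (natDegree_dirichletPoly_le _ _).trans_lt (by omega)
  have h := sum_eval_mul_conj_eval hd hd
  have hm' : (m : ℂ) ≠ 0 := by exact_mod_cast hm.ne'
  simp only [eval_dirichletPoly, Complex.mul_conj', coeff_dirichletPoly] at h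
  have h2 : ∑ a ∈ range N, (‖if a < m then (m : ℂ)⁻¹ * torusChar (-s) ^ a else 0‖ : ℂ) ^ 2 =
      (m : ℂ)⁻¹ := by
    calc _ = ∑ a ∈ range N, if a < m then ((m : ℂ)⁻¹) ^ 2 else 0 := by
          refine sum_congr rfl fun a _ => ?_
          split_ifs <;> simp [norm_torusChar]
      _ = ∑ a ∈ range m, ((m : ℂ)⁻¹) ^ 2 := by
          rw [← sum_filter]
          congr 1
          ext a
          simp only [mem_filter, mem_range]
          omega
      _ = _ := by
          rw [sum_const, card_range, nsmul_eq_mul]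
          field_simp
  rw [h2] at h
  have h3 : ((∑ x ∈ range N, ‖dirichletKernel m (x / N - s)‖ ^ 2 : ℝ) : ℂ) = ((N / m : ℝ) : ℂ) := by
    push_cast
    rw [h, div_eq_mul_inv]
  exact_mod_cast h3

/-! ### The localization kernel and its coefficients -/

/-- The localization kernel, a product of powers of Dirichlet kernels. -/
noncomputable def localKernel (m₁ m₂ β : ℕ) (y : ℝ) : ℂ :=
  dirichletKernel m₁ y * dirichletKernel m₂ y ^ β

/-- The polynomial whose values on the unit circle are the localization kernel centred at `s`. -/
noncomputable def localPoly (m₁ m₂ β : ℕ) (s : ℝ) : ℂ[X] :=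
  dirichletPoly m₁ (torusChar (-s)) * dirichletPoly m₂ (torusChar (-s)) ^ β

lemma eval_localPoly (m₁ m₂ β : ℕ) (s x : ℝ) :
    (localPoly m₁ m₂ β s).eval (torusChar x) = localKernel m₁ m₂ β (x - s) := by
  rw [localPoly, eval_mul, eval_pow, eval_dirichletPoly, eval_dirichletPoly, localKernel]

lemma natDegree_localPoly_le (m₁ m₂ β : ℕ) (s : ℝ) :
    (localPoly m₁ m₂ β s).natDegree ≤ (m₁ - 1) + β * (m₂ - 1) := by
  refine natDegree_mul_le.trans (add_le_add (natDegree_dirichletPoly_le _ _) ?_)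
  exact natDegree_pow_le.trans (Nat.mul_le_mul_left _ (natDegree_dirichletPoly_le _ _))

lemma localKernel_zero {m₁ m₂ : ℕ} (h₁ : m₁ ≠ 0) (h₂ : m₂ ≠ 0) (β : ℕ) :
    localKernel m₁ m₂ β 0 = 1 := by
  rw [localKernel, dirichletKernel_zero h₁, dirichletKernel_zero h₂, one_pow, one_mul]

lemma norm_localKernel_le_one (m₁ m₂ β : ℕ) (y : ℝ) : ‖localKernel m₁ m₂ β y‖ ≤ 1 := by
  rw [localKernel, norm_mul, norm_pow]
  exact mul_le_one₀ (norm_dirichletKernel_le_one _ _) (by positivity)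
    (pow_le_one₀ (norm_nonneg _) (norm_dirichletKernel_le_one _ _))

lemma norm_localKernel_le {m₁ m₂ : ℕ} (β : ℕ) {y a b : ℝ} (ha : 0 < a) (hb : 0 < b)
    (h₁ : a ≤ 2 * m₁ * distInt y) (h₂ : b ≤ 2 * m₂ * distInt y) :
    ‖localKernel m₁ m₂ β y‖ ≤ a⁻¹ * b⁻¹ ^ β := by
  rw [localKernel, norm_mul, norm_pow]
  gcongr
  · exact norm_dirichletKernel_le_inv ha h₁
  · exact norm_dirichletKernel_le_inv hb h₂

/-- Each new coefficient is `1/m` times a sum of at most `m` old coefficients with unimodular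
weights, so the supremum of the coefficients does not grow. -/
lemma norm_coeff_dirichletPoly_mul_le {m : ℕ} {w : ℂ} (hw : ‖w‖ = 1) {q : ℂ[X]} {c : ℝ}
    (hc : ∀ a, ‖q.coeff a‖ ≤ c) (a : ℕ) : ‖(dirichletPoly m w * q).coeff a‖ ≤ c := by
  have hc0 : 0 ≤ c := (norm_nonneg _).trans (hc 0)
  have h : (dirichletPoly m w * q).coeff a =
      (m : ℂ)⁻¹ * ∑ l ∈ range m, w ^ l * (if l ≤ a then q.coeff (a - l) else 0) := by
    rw [dirichletPoly, mul_assoc, coeff_C_mul, sum_mul, finsetSum_coeff]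
    congr 1
    refine sum_congr rfl fun l _ => ?_
    rw [mul_pow, ← C_pow, mul_assoc, coeff_C_mul, coeff_X_pow_mul']
  rw [h, norm_mul, norm_inv, Complex.norm_natCast]
  have h2 : ‖∑ l ∈ range m, w ^ l * (if l ≤ a then q.coeff (a - l) else 0)‖ ≤ m * c := by
    refine (norm_sum_le_of_le (range m) (f := _) (n := fun _ => c) fun l _ => ?_).trans ?_
    · rw [norm_mul, norm_pow, hw, one_pow, one_mul]
      split_ifs
      · exact hc _
      · simpa using hc0
    · simp
  calc (m : ℝ)⁻¹ * _ ≤ (m : ℝ)⁻¹ * (m * c) := by gcongr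
    _ = ((m : ℝ)⁻¹ * m) * c := by ring
    _ ≤ 1 * c := by gcongr; exact inv_mul_le_one
    _ = c := one_mul c

lemma norm_coeff_localPoly_le (m₁ m₂ β : ℕ) (s : ℝ) (a : ℕ) :
    ‖(localPoly m₁ m₂ β s).coeff a‖ ≤ (m₁ : ℝ)⁻¹ := by
  rw [localPoly, mul_comm]
  induction β generalizing a with
  | zero =>
    rw [pow_zero, one_mul, coeff_dirichletPoly]
    split_ifs
    · simp [norm_torusChar]
    · simp
  | succ β ih =>
    rw [pow_succ', mul_assoc]
    exact norm_coeff_dirichletPoly_mul_le (norm_torusChar _) ih a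

lemma dirichletPoly_eq_comp (m : ℕ) (w : ℂ) :
    dirichletPoly m w = (dirichletPoly m 1).comp (C w * X) := by
  simp [dirichletPoly, comp, eval₂_finsetSum, eval₂_pow]

/-- Translating the centre modulates the coefficients by conjugate characters, which are the entries
of `A*`. A combination of translated kernels thus has as coefficient vector a diagonal multiple of
`A* v`. -/
lemma coeff_localPoly (m₁ m₂ β : ℕ) (s : ℝ) (a : ℕ) :
    (localPoly m₁ m₂ β s).coeff a =
      (localPoly m₁ m₂ β 0).coeff a * conj (torusChar s ^ a) := by
  have h : localPoly m₁ m₂ β s = (localPoly m₁ m₂ β 0).comp (C (torusChar (-s)) * X) := by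
    rw [localPoly, localPoly, mul_comp, pow_comp, neg_zero, torusChar_zero,
      ← dirichletPoly_eq_comp, ← dirichletPoly_eq_comp]
  rw [h, comp_C_mul_X_coeff, torusChar_neg, map_pow]

/-- The two factors of the kernel have separate roles: the powers of `D_{m₂}` are bounded pointwise
and give the decay `b ^ β`, while the factors `D_{m₁}` are summed in mean square and give `1/m₁`. -/
lemma norm_sum_coeff_mul_conj_le {N m₁ m₂ β : ℕ} (hm : 0 < m₁) (hmN : m₁ ≤ N) {p q : ℂ[X]}
    (hp : p.natDegree < N) (hq : q.natDegree < N) {s s' g g' b : ℝ}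
    (hg : 0 ≤ g) (hg' : 0 ≤ g')
    (hpg : ∀ x, ‖p.eval (torusChar x)‖ ≤ g * ‖localKernel m₁ m₂ β (x - s)‖)
    (hqg : ∀ x, ‖q.eval (torusChar x)‖ ≤ g' * ‖localKernel m₁ m₂ β (x - s')‖)
    (hb : ∀ x, ‖dirichletKernel m₂ (x - s)‖ * ‖dirichletKernel m₂ (x - s')‖ ≤ b) :
    ‖∑ a ∈ range N, p.coeff a * conj (q.coeff a)‖ ≤ g * g' * ((m₁ : ℝ)⁻¹ * b ^ β) := by
  have hN : (0 : ℝ) < N := by exact_mod_cast hm.trans_le hmN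
  have hb0 : 0 ≤ b := le_trans (by positivity) (hb 0)
  have h1 : N * ‖∑ a ∈ range N, p.coeff a * conj (q.coeff a)‖ =
      ‖∑ x ∈ range N, p.eval (torusChar (x / N)) * conj (q.eval (torusChar (x / N)))‖ := by
    rw [sum_eval_mul_conj_eval hp hq, norm_mul, Complex.norm_natCast]
  have h2 (x : ℝ) : ‖p.eval (torusChar x) * conj (q.eval (torusChar x))‖ ≤
      g * g' * b ^ β * ((‖dirichletKernel m₁ (x - s)‖ ^ 2 +
        ‖dirichletKernel m₁ (x - s')‖ ^ 2) / 2) := by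
    rw [norm_mul, RCLike.norm_conj]
    have e1 := hpg x
    have e2 := hqg x
    rw [localKernel, norm_mul, norm_pow] at e1 e2
    set u := ‖dirichletKernel m₁ (x - s)‖
    set u' := ‖dirichletKernel m₁ (x - s')‖
    calc _ ≤ (g * (u * ‖dirichletKernel m₂ (x - s)‖ ^ β)) *
          (g' * (u' * ‖dirichletKernel m₂ (x - s')‖ ^ β)) := by
            apply mul_le_mul e1 e2 (norm_nonneg _) (by positivity)
      _ = g * g' * (‖dirichletKernel m₂ (x - s)‖ * ‖dirichletKernel m₂ (x - s')‖) ^ β *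
          (u * u') := by rw [mul_pow]; ring
      _ ≤ g * g' * b ^ β * ((u ^ 2 + u' ^ 2) / 2) := by
          gcongr
          · exact hb x
          · nlinarith [sq_nonneg (u - u')]
  have h3 : N * ‖∑ a ∈ range N, p.coeff a * conj (q.coeff a)‖ ≤
      N * (g * g' * ((m₁ : ℝ)⁻¹ * b ^ β)) := by
    rw [h1]
    refine (norm_sum_le_of_le _ fun (x : ℕ) _ => h2 (x / N)).trans (le_of_eq ?_)
    rw [← mul_sum, ← sum_div, sum_add_distrib, sum_norm_dirichletKernel_sq hm hmN,
      sum_norm_dirichletKernel_sq hm hmN]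
    ring
  exact le_of_mul_le_mul_left h3 hN

end

/-! ### The wrap-around norm and packing of clusters -/

section

open Finset

lemma bddBelow_range_norm_add_int {d : ℕ} (x : Fin d → ℝ) :
    BddBelow (Set.range fun r : Fin d → ℤ => ‖fun i => x i + (r i : ℝ)‖) :=
  ⟨0, by rintro _ ⟨r, rfl⟩; exact norm_nonneg _⟩

lemma wrapNorm_le_norm_add_int {d : ℕ} (x : Fin d → ℝ) (r : Fin d → ℤ) :
    wrapNorm x ≤ ‖fun i => x i + (r i : ℝ)‖ :=
  ciInf_le (bddBelow_range_norm_add_int x) r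

lemma wrapNorm_eq_norm_sub_round {d : ℕ} (x : Fin d → ℝ) :
    wrapNorm x = ‖fun i => x i - round (x i)‖ := by
  apply le_antisymm
  · simpa [← sub_eq_add_neg] using wrapNorm_le_norm_add_int x fun i => -round (x i)
  · refine le_ciInf fun r => (pi_norm_le_iff_of_nonneg (norm_nonneg _)).2 fun i => ?_
    exact (distInt_le_abs_add_int (x i) (r i)).trans
      (norm_le_pi_norm (fun i => x i + (r i : ℝ)) i)

lemma wrapNorm_nonneg {d : ℕ} (x : Fin d → ℝ) : 0 ≤ wrapNorm x := by
  rw [wrapNorm_eq_norm_sub_round]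
  exact norm_nonneg _

lemma distInt_le_wrapNorm {d : ℕ} (x : Fin d → ℝ) (i : Fin d) : distInt (x i) ≤ wrapNorm x := by
  rw [wrapNorm_eq_norm_sub_round]
  exact norm_le_pi_norm (fun i => x i - (round (x i) : ℝ)) i

lemma exists_abs_eq_norm {d : ℕ} (hd : 1 ≤ d) (x : Fin d → ℝ) : ∃ i, |x i| = ‖x‖ := by
  have : Nonempty (Fin d) := ⟨⟨0, hd⟩⟩
  obtain ⟨i, -, hi⟩ := exists_max_image univ (fun i => |x i|) univ_nonempty
  refine ⟨i, le_antisymm (norm_le_pi_norm x i) ?_⟩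
  exact (pi_norm_le_iff_of_nonneg (abs_nonneg _)).2 fun j => hi j (mem_univ j)

lemma exists_distInt_eq_wrapNorm {d : ℕ} (hd : 1 ≤ d) (x : Fin d → ℝ) :
    ∃ i, distInt (x i) = wrapNorm x := by
  rw [wrapNorm_eq_norm_sub_round]
  exact exists_abs_eq_norm hd _

lemma wrapNorm_sub_comm {d : ℕ} (hd : 1 ≤ d) (x y : Fin d → ℝ) :
    wrapNorm (x - y) = wrapNorm (y - x) := by
  have h (x y : Fin d → ℝ) : wrapNorm (x - y) ≤ wrapNorm (y - x) := by
    obtain ⟨i, hi⟩ := exists_distInt_eq_wrapNorm hd (x - y)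
    rw [← hi, Pi.sub_apply, distInt_sub_comm]
    exact distInt_le_wrapNorm (y - x) i
  exact le_antisymm (h x y) (h y x)

/-- With `d = e + 1`, the lower terms of the binomial expansion have total weight `2^d - 1`, and
each power of `k` in them is at most `k^(d-1)`. Equality holds at `k = 1`. -/
lemma succ_pow_succ_le (e k : ℕ) (hk : 1 ≤ k) :
    (k + 1 : ℝ) ^ (e + 1) ≤ (k : ℝ) ^ (e + 1) + (2 ^ (e + 1) - 1) * (k : ℝ) ^ e := by
  have hk' : (1 : ℝ) ≤ k := by exact_mod_cast hk
  induction e with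
  | zero => norm_num
  | succ e ih =>
    have h1 : (0 : ℝ) ≤ 2 ^ (e + 1) - 1 := by
      have : (1 : ℝ) ≤ 2 ^ (e + 1) := one_le_pow₀ (by norm_num)
      linarith
    have h2 : (k : ℝ) ^ e ≤ (k : ℝ) ^ (e + 1) := pow_le_pow_right₀ hk' (by omega)
    calc (k + 1 : ℝ) ^ (e + 1 + 1) = (k + 1 : ℝ) ^ (e + 1) * (k + 1) := pow_succ _ _
      _ ≤ ((k : ℝ) ^ (e + 1) + (2 ^ (e + 1) - 1) * (k : ℝ) ^ e) * (k + 1) := by gcongr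
      _ = (k : ℝ) ^ (e + 1 + 1) + (k : ℝ) ^ (e + 1) +
          (2 ^ (e + 1) - 1) * ((k : ℝ) ^ (e + 1) + (k : ℝ) ^ e) := by ring
      _ ≤ (k : ℝ) ^ (e + 1 + 1) + (k : ℝ) ^ (e + 1) +
          (2 ^ (e + 1) - 1) * ((k : ℝ) ^ (e + 1) + (k : ℝ) ^ (e + 1)) := by gcongr
      _ = _ := by ring

lemma abs_sub_lt_of_floor_eq {δ u v : ℝ} (hδ : 0 < δ) (hs : 0 ≤ u ↔ 0 ≤ v)
    (hf : ⌊|u| / δ⌋₊ = ⌊|v| / δ⌋₊) : |u - v| < δ := by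
  have hu := Nat.floor_le (a := |u| / δ) (by positivity)
  have hv := Nat.floor_le (a := |v| / δ) (by positivity)
  have hu' := Nat.lt_floor_add_one (|u| / δ)
  have hv' := Nat.lt_floor_add_one (|v| / δ)
  rw [hf] at hu hu'
  rw [le_div_iff₀ hδ] at hu hv
  rw [div_lt_iff₀ hδ] at hu' hv'
  have h : |u - v| = |(|u| - |v|)| := by
    rcases le_or_gt 0 u with h0 | h0
    · rw [abs_of_nonneg h0, abs_of_nonneg (hs.1 h0)]
    · have h1 : v < 0 := not_le.1 fun h => not_lt.2 (hs.2 h) h0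
      rw [abs_of_neg h0, abs_of_neg h1, ← abs_neg]
      ring_nf
  rw [h, abs_lt]
  constructor <;> linarith

/-- A shell of a grid of cubes contains few clusters that are separated by the mesh size. -/
lemma card_shell_le {ι κ : Type*} {d : ℕ} (hd : 1 ≤ d) [DecidableEq κ] (S : Finset ι)
    (x : ι → Fin d → ℝ) (c : ι → κ) {δ : ℝ} (hδ : 0 < δ) {lam : ℕ}
    (hsep : ∀ a ∈ S, ∀ b ∈ S, c a ≠ c b → δ ≤ ‖x a - x b‖)
    (hcard : ∀ a ∈ S, #{b ∈ S | c b = c a} ≤ lam) (k : ℕ) :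
    #{a ∈ S | ⌊‖x a‖ / δ⌋₊ = k} ≤ lam * ((2 * (k + 1)) ^ d - (2 * k) ^ d) := by
  classical
  set F := {a ∈ S | ⌊‖x a‖ / δ⌋₊ = k}
  -- A bin is a grid cube of side `δ`, given by signs and floors. Shell `k` consists of the bins in
  -- `box (k + 1)` outside `box k`, and two points in one bin are closer than `δ`, hence in the same
  -- cluster.
  let bin : ι → Fin d → Bool × ℕ := fun a i => (decide (0 ≤ x a i), ⌊|x a i| / δ⌋₊)
  let box : ℕ → Finset (Fin d → Bool × ℕ) := fun k => Fintype.piFinset fun _ => univ ×ˢ range k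
  have hbox (k : ℕ) : #(box k) = (2 * k) ^ d := by
    simp [box, Fintype.card_piFinset]
  have hsub : box k ⊆ box (k + 1) := by
    apply Fintype.piFinset_subset
    intro i
    exact product_subset_product_right (range_mono (Nat.le_succ k))
  have himg : F.image bin ⊆ box (k + 1) \ box k := by
    intro y hy
    obtain ⟨a, ha, rfl⟩ := mem_image.1 hy
    have hk : ⌊‖x a‖ / δ⌋₊ = k := (mem_filter.1 ha).2
    rw [mem_sdiff, Fintype.mem_piFinset, Fintype.mem_piFinset]
    constructor
    · intro i
      have : ⌊|x a i| / δ⌋₊ ≤ ⌊‖x a‖ / δ⌋₊ := by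
        apply Nat.floor_le_floor
        gcongr
        exact norm_le_pi_norm (x a) i
      simp only [bin, mem_product, mem_univ, mem_range, true_and]
      omega
    · intro h
      obtain ⟨i, hi⟩ := exists_abs_eq_norm hd (x a)
      have := h i
      simp only [bin, mem_product, mem_univ, mem_range, true_and, hi, hk] at this
      omega
  have hfib : ∀ y ∈ F.image bin, #{a ∈ F | bin a = y} ≤ lam := by
    intro y hy
    obtain ⟨a, ha, rfl⟩ := mem_image.1 hy
    have haS := (mem_filter.1 ha).1
    refine (card_le_card fun b hb => ?_).trans (hcard a haS)
    obtain ⟨hbF, hab⟩ := mem_filter.1 hb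
    have hbS := (mem_filter.1 hbF).1
    refine mem_filter.2 ⟨hbS, ?_⟩
    by_contra hne
    refine (hsep b hbS a haS hne).not_gt ?_
    refine (pi_norm_lt_iff hδ).2 fun i => ?_
    have := congrFun hab i
    simp only [bin, Prod.mk.injEq, decide_eq_decide] at this
    exact abs_sub_lt_of_floor_eq hδ this.1 this.2
  calc #F ≤ lam * #(F.image bin) := card_le_mul_card_image F lam hfib
    _ ≤ lam * #(box (k + 1) \ box k) := Nat.mul_le_mul_left _ (card_le_card himg)
    _ = _ := by rw [card_sdiff_of_subset hsub, hbox, hbox]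

/-- Shell `k` holds at most `lam * 2^d (2^d - 1) k^(d-1)` points, each contributing at most
`k^(-β)`; summing over `k ≥ 1` gives the zeta value. The term `n = 0` of the series is `1/0 = 0`. -/
lemma sum_div_norm_pow_le {ι κ : Type*} {d : ℕ} (hd : 1 ≤ d) [DecidableEq κ] (S : Finset ι)
    (x : ι → Fin d → ℝ) (c : ι → κ) {δ : ℝ} (hδ : 0 < δ) {lam β : ℕ} (hβ : d + 1 ≤ β)
    (hx : ∀ a ∈ S, δ ≤ ‖x a‖)
    (hsep : ∀ a ∈ S, ∀ b ∈ S, c a ≠ c b → δ ≤ ‖x a - x b‖)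
    (hcard : ∀ a ∈ S, #{b ∈ S | c b = c a} ≤ lam) :
    ∑ a ∈ S, (δ / ‖x a‖) ^ β ≤
      lam * (2 ^ d * (2 ^ d - 1)) * ∑' n : ℕ, 1 / (n : ℝ) ^ (β - d + 1) := by
  classical
  let q : ι → ℕ := fun a => ⌊‖x a‖ / δ⌋₊
  have hq1 : ∀ a ∈ S, 1 ≤ q a := fun a ha => by
    rw [Nat.one_le_floor_iff, one_le_div hδ]
    exact hx a ha
  have hsum : Summable fun n : ℕ => 1 / (n : ℝ) ^ (β - d + 1) :=
    Real.summable_one_div_nat_pow.2 (by omega)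
  have hterm : ∀ a ∈ S, (δ / ‖x a‖) ^ β ≤ 1 / (q a : ℝ) ^ β := fun a ha => by
    have h0 : 0 < ‖x a‖ := hδ.trans_le (hx a ha)
    have h1 : (0 : ℝ) < q a := by exact_mod_cast hq1 a ha
    have h2 : (q a : ℝ) ≤ ‖x a‖ / δ := Nat.floor_le (by positivity)
    rw [← one_div_pow]
    refine pow_le_pow_left₀ (by positivity) ?_ β
    rw [div_le_div_iff₀ h0 h1, one_mul]
    rw [le_div_iff₀ hδ] at h2
    linarith
  have hpow : (1 : ℝ) ≤ 2 ^ d := one_le_pow₀ (by norm_num)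
  have hfib : ∀ k ∈ S.image q, ∑ a ∈ S with q a = k, 1 / (q a : ℝ) ^ β ≤
      lam * (2 ^ d * (2 ^ d - 1)) * (1 / (k : ℝ) ^ (β - d + 1)) := by
    intro k hk
    obtain ⟨a, ha, rfl⟩ := mem_image.1 hk
    set k := q a
    have hk1 : 1 ≤ k := hq1 a ha
    have hk0 : (0 : ℝ) < k := by exact_mod_cast hk1
    have h1 : ∑ a ∈ S with q a = k, 1 / (q a : ℝ) ^ β = #{a ∈ S | q a = k} * (1 / (k : ℝ) ^ β) := by
      rw [← nsmul_eq_mul, ← sum_const]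
      exact sum_congr rfl fun b hb => by rw [(mem_filter.1 hb).2]
    have h2 : (#{a ∈ S | q a = k} : ℝ) ≤ lam * (2 ^ d * ((2 ^ d - 1) * (k : ℝ) ^ (d - 1))) := by
      have h3 := card_shell_le hd S x c hδ hsep hcard k
      have h4 : (2 * k) ^ d ≤ (2 * (k + 1)) ^ d := Nat.pow_le_pow_left (by omega) d
      have h5 : (#{a ∈ S | q a = k} : ℝ) ≤ lam * ((2 * (k + 1)) ^ d - (2 * k) ^ d) := by
        exact_mod_cast h3
      refine h5.trans ?_
      gcongr
      rw [mul_pow, mul_pow, ← mul_sub]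
      gcongr
      obtain ⟨e, rfl⟩ : ∃ e, d = e + 1 := ⟨d - 1, by omega⟩
      have := succ_pow_succ_le e k hk1
      simp only [Nat.add_sub_cancel]
      linarith
    have h6 : (k : ℝ) ^ (d - 1) * (1 / (k : ℝ) ^ β) = 1 / (k : ℝ) ^ (β - d + 1) := by
      have : β = (d - 1) + (β - d + 1) := by omega
      rw [eq_div_iff (by positivity), mul_one_div, div_mul_eq_mul_div, ← pow_add, ← this]
      exact div_self (by positivity)
    rw [h1, ← h6]
    calc _ ≤ (lam * (2 ^ d * ((2 ^ d - 1) * (k : ℝ) ^ (d - 1)))) * (1 / (k : ℝ) ^ β) := by gcongr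
      _ = _ := by ring
  calc ∑ a ∈ S, (δ / ‖x a‖) ^ β ≤ ∑ a ∈ S, 1 / (q a : ℝ) ^ β := sum_le_sum hterm
    _ = ∑ k ∈ S.image q, ∑ a ∈ S with q a = k, 1 / (q a : ℝ) ^ β :=
        (sum_fiberwise_of_maps_to (fun a ha => mem_image_of_mem q ha) _).symm
    _ ≤ ∑ k ∈ S.image q, lam * (2 ^ d * (2 ^ d - 1)) * (1 / (k : ℝ) ^ (β - d + 1)) :=
        sum_le_sum hfib
    _ = lam * (2 ^ d * (2 ^ d - 1)) * ∑ k ∈ S.image q, 1 / (k : ℝ) ^ (β - d + 1) := by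
        rw [mul_sum]
    _ ≤ _ := by
        have : (0 : ℝ) ≤ 2 ^ d - 1 := by linarith
        gcongr
        exact hsum.sum_le_tsum _ fun _ _ => by positivity

/-- The packing estimate for clusters on the torus. -/
lemma sum_div_wrapNorm_pow_le {ι κ : Type*} {d : ℕ} (hd : 1 ≤ d) [DecidableEq κ] (S : Finset ι)
    (t : ι → Fin d → ℝ) (y : Fin d → ℝ) (c : ι → κ) {δ : ℝ} (hδ : 0 < δ) {lam β : ℕ}
    (hβ : d + 1 ≤ β) (hy : ∀ a ∈ S, δ ≤ wrapNorm (t a - y))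
    (hsep : ∀ a ∈ S, ∀ b ∈ S, c a ≠ c b → δ ≤ wrapNorm (t a - t b))
    (hcard : ∀ a ∈ S, #{b ∈ S | c b = c a} ≤ lam) :
    ∑ a ∈ S, (δ / wrapNorm (t a - y)) ^ β ≤
      lam * (2 ^ d * (2 ^ d - 1)) * ∑' n : ℕ, 1 / (n : ℝ) ^ (β - d + 1) := by
  -- Representatives in `[-1/2, 1/2]^d` reduce the torus to `ℝ^d`: their norms are the wrap-around
  -- norms, and their mutual distances are at least those on the torus.
  let x : ι → Fin d → ℝ := fun a i => (t a - y) i - round ((t a - y) i)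
  have hx (a : ι) : wrapNorm (t a - y) = ‖x a‖ := wrapNorm_eq_norm_sub_round _
  simp only [hx] at hy ⊢
  refine sum_div_norm_pow_le hd S x c hδ hβ hy (fun a ha b hb hab => ?_) hcard
  refine (hsep a ha b hb hab).trans ?_
  have := wrapNorm_le_norm_add_int (t a - t b)
    fun i => round ((t b - y) i) - round ((t a - y) i)
  refine this.trans (le_of_eq (congrArg norm (funext fun i => ?_)))
  simp only [x, Pi.sub_apply]
  push_cast
  ring

lemma riemannZeta_natCast_re {k : ℕ} (hk : 1 < k) :
    (riemannZeta k).re = ∑' n : ℕ, 1 / (n : ℝ) ^ k := by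
  rw [zeta_nat_eq_tsum_of_gt_one hk]
  have : ∑' n : ℕ, 1 / (n : ℂ) ^ k = ((∑' n : ℕ, 1 / (n : ℝ) ^ k : ℝ) : ℂ) := by
    push_cast
    rfl
  rw [this, Complex.ofReal_re]

lemma one_le_tsum_one_div_pow {k : ℕ} (hk : 1 < k) : 1 ≤ ∑' n : ℕ, 1 / (n : ℝ) ^ k := by
  have hs : Summable fun n : ℕ => 1 / (n : ℝ) ^ k := Real.summable_one_div_nat_pow.2 hk
  have := hs.le_tsum 1 fun _ _ => by positivity
  simpa using this

end

/-! ### Geometry of the clustered configuration -/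

section

open Finset Polynomial ComplexConjugate

variable {d M L N : ℕ} {t : Fin M → Fin d → ℝ} {Λ : Fin L → Finset (Fin d → ℝ)}

lemma clusterSeparation_le (hd : 1 ≤ d) {l l' : Fin L} (hl : l ≠ l') {x y : Fin d → ℝ}
    (hx : x ∈ Λ l) (hy : y ∈ Λ l') :
    clusterSeparation N Λ ≤ ENNReal.ofReal (N * wrapNorm (x - y)) := by
  wlog h : l < l' generalizing l l' x y
  · rw [wrapNorm_sub_comm hd]
    exact this hl.symm hy hx (lt_of_le_of_ne (not_lt.1 h) hl.symm)
  rw [ENNReal.ofReal_mul (Nat.cast_nonneg N), ENNReal.ofReal_natCast, clusterSeparation]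
  gcongr
  refine (iInf_le_of_le l <| iInf_le_of_le l' <| iInf_le _ h).trans ?_
  exact iInf_le_of_le x <| iInf_le_of_le hx <| iInf_le_of_le y <| iInf_le _ hy

lemma le_mul_wrapNorm_of_le_clusterSeparation (hd : 1 ≤ d) {R : ℝ}
    (hR : ENNReal.ofReal R ≤ clusterSeparation N Λ) {l l' : Fin L} (hl : l ≠ l')
    {x y : Fin d → ℝ} (hx : x ∈ Λ l) (hy : y ∈ Λ l') : R ≤ N * wrapNorm (x - y) :=
  (ENNReal.ofReal_le_ofReal_iff (mul_nonneg (Nat.cast_nonneg N) (wrapNorm_nonneg _))).1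
    (hR.trans (clusterSeparation_le hd hl hx hy))

lemma IsCluster.wrapNorm_sub_le {S : Finset (Fin d → ℝ)} (hS : IsCluster N S) {x y : Fin d → ℝ}
    (hx : x ∈ S) (hy : y ∈ S) : wrapNorm (x - y) ≤ 1 / N := by
  obtain ⟨a, ha⟩ := hS
  obtain ⟨r, hr⟩ := ha x hx
  obtain ⟨r', hr'⟩ := ha y hy
  refine (wrapNorm_le_norm_add_int (x - y) fun i => r i - r' i).trans ?_
  refine (pi_norm_le_iff_of_nonneg (by positivity)).2 fun i => ?_
  rw [Real.norm_eq_abs, abs_le, Pi.sub_apply]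
  push_cast
  constructor <;> linarith [hr i, hr' i]

/-- If the distance were zero, all coordinate differences would be integers; they lie in `(-1, 1)`,
so they would vanish. -/
lemma IsClusteredConfiguration.wrapNorm_sub_pos (hΩ : IsClusteredConfiguration N t Λ)
    {j k : Fin M} (hjk : j ≠ k) : 0 < wrapNorm (t j - t k) := by
  refine (wrapNorm_nonneg _).lt_of_ne' fun h => hjk (hΩ.injective (funext fun i => ?_))
  have h1 : distInt ((t j - t k) i) = 0 :=
    le_antisymm ((distInt_le_wrapNorm _ i).trans h.le) (distInt_nonneg _)
  rw [distInt, abs_eq_zero, Pi.sub_apply, sub_eq_zero] at h1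
  have hj := hΩ.mem_Ico j i
  have hk := hΩ.mem_Ico k i
  set r := round (t j i - t k i)
  have h2 : (r : ℝ) < 1 := by linarith [hj.2, hk.1]
  have h3 : (-1 : ℝ) < r := by linarith [hk.2, hj.1]
  have h4 : r = 0 := by
    have h2' : r < 1 := by exact_mod_cast h2
    have h3' : -1 < r := by exact_mod_cast h3
    omega
  rw [h4, Int.cast_zero] at h1
  linarith

lemma IsClusteredConfiguration.exists_label (hΩ : IsClusteredConfiguration N t Λ) :
    ∃ c : Fin M → Fin L, ∀ j, t j ∈ Λ (c j) := by
  have h (j : Fin M) : ∃ l, t j ∈ Λ l := by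
    have : t j ∈ ⋃ l, (Λ l : Set (Fin d → ℝ)) := hΩ.range_eq ▸ Set.mem_range_self j
    simpa using this
  choose c hc using h
  exact ⟨c, hc⟩

lemma card_label_le (ht : Function.Injective t) {c : Fin M → Fin L} (hc : ∀ j, t j ∈ Λ (c j))
    (l : Fin L) : #{k | c k = l} ≤ biggestClusterSize Λ := by
  refine le_trans ?_ (le_sup (f := fun l => #(Λ l)) (mem_univ l))
  refine card_le_card_of_injOn t (fun k hk => ?_) ht.injOn
  have : c k = l := by simpa using hk
  exact this ▸ hc k

/-- The factors omitted from `T` belong to nodes within `1/N`, so each of them is at least `1`. -/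
lemma prod_le_clusterComplexity (ht : Function.Injective t) (hN : 0 < N) (j : Fin M)
    (T : Finset (Fin M))
    (hT : ∀ k ∈ T, 0 < wrapNorm (t j - t k) ∧ wrapNorm (t j - t k) ≤ 1 / (N : ℝ)) :
    ∏ k ∈ T, 1 / ((N : ℝ) * wrapNorm (t j - t k)) ≤ clusterComplexity N t := by
  classical
  have hN' : (0 : ℝ) < N := by exact_mod_cast hN
  refine le_trans ?_ (le_ciSup (Set.finite_range _).bddAbove j)
  rw [← prod_image (f := fun x => 1 / ((N : ℝ) * wrapNorm (t j - x))) ht.injOn]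
  have hsub : T.image t ⊆ (univ.image t).filter
      (fun x => 0 < wrapNorm (t j - x) ∧ wrapNorm (t j - x) ≤ 1 / (N : ℝ)) := by
    intro x hx
    obtain ⟨k, hk, rfl⟩ := mem_image.1 hx
    exact mem_filter.2 ⟨mem_image_of_mem t (mem_univ k), hT k hk⟩
  refine le_of_le_of_eq ?_ (prod_congr (by congr!) fun _ _ => rfl)
  rw [← prod_sdiff hsub]
  refine le_mul_of_one_le_left (prod_nonneg fun x _ => ?_) ?_
  · have := wrapNorm_nonneg (t j - x)
    positivity
  · refine Finset.one_le_prod fun x hx => ?_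
    obtain ⟨-, h1, h2⟩ := mem_filter.1 (mem_sdiff.1 hx).1
    rw [one_le_div (by positivity)]
    rw [le_div_iff₀ hN'] at h2
    linarith

lemma one_le_clusterComplexity (hM : 1 ≤ M) (ht : Function.Injective t) (hN : 0 < N) :
    1 ≤ clusterComplexity N t := by
  simpa using prod_le_clusterComplexity ht hN ⟨0, hM⟩ ∅ (by simp)

/-! ### Localized Lagrange polynomials -/

/-- A polynomial that is `1` at `exp(2πis)` and vanishes at `exp(2πiu)`. -/
noncomputable def nodePoly (n : ℕ) (s u : ℝ) : ℂ[X] :=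
  C (torusChar s ^ n - torusChar u ^ n)⁻¹ * (X ^ n - C (torusChar u ^ n))

lemma natDegree_nodePoly_le (n : ℕ) (s u : ℝ) : (nodePoly n s u).natDegree ≤ n := by
  refine (natDegree_C_mul_le _ _).trans ?_
  rw [natDegree_X_pow_sub_C]

lemma eval_nodePoly_eq_zero (n : ℕ) (s u : ℝ) : (nodePoly n s u).eval (torusChar u) = 0 := by
  simp [nodePoly]

lemma le_norm_torusChar_pow_sub {n : ℕ} {s u : ℝ} (hn : n * distInt (s - u) ≤ 1 / 4) :
    16 / 3 * (n * distInt (s - u)) ≤ ‖torusChar s ^ n - torusChar u ^ n‖ := by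
  have h1 : torusChar s ^ n - torusChar u ^ n =
      -(torusChar u ^ n * (1 - torusChar (n * ((s - u) - round (s - u))))) := by
    have h2 : torusChar s = torusChar u * torusChar (s - u) := by
      rw [← torusChar_add]
      ring_nf
    rw [torusChar_natCast_mul, torusChar_sub_round, h2, mul_pow]
    ring
  have h3 : |(n : ℝ) * ((s - u) - round (s - u))| = n * distInt (s - u) := by
    rw [abs_mul, Nat.abs_cast, distInt]
  rw [h1, norm_neg, norm_mul, norm_pow, norm_torusChar, one_pow, one_mul, ← h3]
  exact norm_one_sub_torusChar_ge_of_abs_le_quarter (h3.trans_le hn)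

lemma eval_nodePoly_self {n : ℕ} {s u : ℝ} (hn : n * distInt (s - u) ≤ 1 / 4)
    (h0 : 0 < n * distInt (s - u)) : (nodePoly n s u).eval (torusChar s) = 1 := by
  have h1 := le_norm_torusChar_pow_sub hn
  have h2 : torusChar s ^ n - torusChar u ^ n ≠ 0 := norm_pos_iff.1 (by linarith)
  simp [nodePoly, inv_mul_cancel₀ h2]

/-- Taking `n`-th powers spreads two close nodes apart: the numerator is at most `2` and the
denominator at least `16/3 * n * distInt (s - u) ≥ 2 * b`. With `8λn ≥ 3N`, one may take `b = N *
distInt (s - u) / λ`. -/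
lemma norm_eval_nodePoly_le {n : ℕ} {s u b : ℝ} (hn : n * distInt (s - u) ≤ 1 / 4)
    (hb : 0 < b) (h0 : 3 * b ≤ 8 * (n * distInt (s - u))) (x : ℝ) :
    ‖(nodePoly n s u).eval (torusChar x)‖ ≤ 1 / b := by
  have h1 := le_norm_torusChar_pow_sub hn
  simp only [nodePoly, eval_mul, eval_C, eval_sub, eval_pow, eval_X, norm_mul, norm_inv]
  have h2 : ‖torusChar x ^ n - torusChar u ^ n‖ ≤ 2 := by
    refine (norm_sub_le _ _).trans ?_
    simp only [norm_pow, norm_torusChar, one_pow]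
    norm_num
  calc _ ≤ (2 * b)⁻¹ * 2 := by
        gcongr
        linarith
    _ = 1 / b := by field_simp

/-- Localized Lagrange polynomials for a cluster: the properties used of the family `p k i`, whose
products `∏ i, p k i (exp(2πi x_i))` interpolate on the cluster of the node `t k`. -/
structure IsLocalLagrange (N m₁ m₂ β : ℕ) (t : Fin M → Fin d → ℝ) (c : Fin M → Fin L) (G : ℝ)
    (p : Fin M → Fin d → ℂ[X]) (g : Fin M → Fin d → ℝ) : Prop where
  natDegree_lt : ∀ k i, (p k i).natDegree < N
  nonneg : ∀ k i, 0 ≤ g k i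
  prod_le : ∀ k, ∏ i, g k i ≤ G
  eval_self : ∀ k i, (p k i).eval (torusChar (t k i)) = 1
  prod_eval_eq_zero : ∀ j k, j ≠ k → c j = c k → ∏ i, (p k i).eval (torusChar (t j i)) = 0
  norm_eval_le : ∀ k i x,
    ‖(p k i).eval (torusChar x)‖ ≤ g k i * ‖localKernel m₁ m₂ β (x - t k i)‖

lemma isLocalLagrange_localPoly {m₁ m₂ β : ℕ} (h₁ : m₁ ≠ 0) (h₂ : m₂ ≠ 0)
    (hdeg : (m₁ - 1) + β * (m₂ - 1) < N) {c : Fin M → Fin L} (hc : Function.Injective c)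
    {G : ℝ} (hG : 1 ≤ G) :
    IsLocalLagrange N m₁ m₂ β t c G (fun k i => localPoly m₁ m₂ β (t k i)) (fun _ _ => 1) where
  natDegree_lt k i := (natDegree_localPoly_le _ _ _ _).trans_lt hdeg
  nonneg _ _ := zero_le_one
  prod_le k := by simpa using hG
  eval_self k i := by rw [eval_localPoly, sub_self, localKernel_zero h₁ h₂]
  prod_eval_eq_zero j k hjk h := absurd (hc h) hjk
  norm_eval_le k i x := by rw [eval_localPoly, one_mul]

lemma exists_isLocalLagrange (hd : 1 ≤ d) {m₁ m₂ β n lam : ℕ} (h₁ : m₁ ≠ 0) (h₂ : m₂ ≠ 0)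
    (hn : 0 < n) (hlam : 0 < lam)
    (hdeg : (m₁ - 1) + β * (m₂ - 1) + (lam - 1) * n < N) (hnN : 4 * n ≤ N)
    (hnlam : 3 * N ≤ 8 * (lam * n)) {c : Fin M → Fin L}
    (hcard : ∀ l, #{k | c k = l} ≤ lam)
    (hpos : ∀ j k, j ≠ k → 0 < wrapNorm (t j - t k))
    (hle : ∀ j k, c j = c k → wrapNorm (t j - t k) ≤ 1 / N)
    {K : ℝ} (hK : ∀ k, ∏ k' ∈ univ.filter (fun k' => c k' = c k ∧ k' ≠ k),
      1 / (N * wrapNorm (t k - t k')) ≤ K) :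
    ∃ p g, IsLocalLagrange N m₁ m₂ β t c ((lam : ℝ) ^ (lam - 1) * K) p g := by
  have hN' : (0 : ℝ) < N := by
    have : 0 < N := by omega
    exact_mod_cast this
  have hn' : (0 : ℝ) < n := by exact_mod_cast hn
  have hlam' : (1 : ℝ) ≤ lam := by exact_mod_cast hlam
  have hnN' : 4 * (n : ℝ) ≤ N := by exact_mod_cast hnN
  have hnlam' : 3 * (N : ℝ) ≤ 8 * (lam * n) := by exact_mod_cast hnlam
  choose i₀ hi₀ using fun j k => exists_distInt_eq_wrapNorm hd (t j - t k)
  let T : Fin M → Finset (Fin M) := fun k => univ.filter fun k' => c k' = c k ∧ k' ≠ k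
  have hT {k k' : Fin M} (h : k' ∈ T k) : c k' = c k ∧ k' ≠ k := (mem_filter.1 h).2
  have hTcard (k : Fin M) : #(T k) ≤ lam - 1 := by
    have h1 : T k = (univ.filter fun k' => c k' = c k).erase k := by
      ext k'
      simp [T, and_comm]
    have h2 := hcard (c k)
    rw [h1, card_erase_of_mem (by simp)]
    omega
  have hdpos {k k' : Fin M} (h : k' ∈ T k) : 0 < wrapNorm (t k - t k') :=
    hpos k k' (hT h).2.symm
  have hdle {k k' : Fin M} (h : k' ∈ T k) : n * wrapNorm (t k - t k') ≤ 1 / 4 := by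
    have h1 := hle k k' (hT h).1.symm
    calc (n : ℝ) * wrapNorm (t k - t k') ≤ n * (1 / N) := by gcongr
      _ ≤ 1 / 4 := by
        rw [mul_one_div, div_le_div_iff₀ hN' (by norm_num)]
        linarith
  -- Each other node of the cluster is eliminated in one coordinate only, one where the wrap-around
  -- distance is attained. The sets `U k i` partition `T k`, so the product over coordinates
  -- contains each distance once.
  let U : Fin M → Fin d → Finset (Fin M) := fun k i => {k' ∈ T k | i₀ k k' = i}
  let P : Fin M → Fin d → ℂ[X] := fun k i =>
    localPoly m₁ m₂ β (t k i) * ∏ k' ∈ U k i, nodePoly n (t k i) (t k' i)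
  let g : Fin M → Fin d → ℝ := fun k i =>
    ∏ k' ∈ U k i, lam * (1 / (N * wrapNorm (t k - t k')))
  have hU {k k' : Fin M} {i : Fin d} (h : k' ∈ U k i) :
      k' ∈ T k ∧ distInt (t k i - t k' i) = wrapNorm (t k - t k') := by
    obtain ⟨h1, rfl⟩ := mem_filter.1 h
    exact ⟨h1, hi₀ k k'⟩
  refine ⟨P, g, ?_, ?_, ?_, ?_, ?_, ?_⟩
  · intro k i
    refine natDegree_mul_le.trans_lt (lt_of_le_of_lt ?_ hdeg)
    refine add_le_add (natDegree_localPoly_le _ _ _ _) ?_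
    refine (natDegree_prod_le _ _).trans ?_
    calc _ ≤ ∑ k' ∈ U k i, n := sum_le_sum fun k' _ => natDegree_nodePoly_le _ _ _
      _ = #(U k i) * n := by simp
      _ ≤ (lam - 1) * n :=
        Nat.mul_le_mul_right _ ((card_le_card (filter_subset _ _)).trans (hTcard k))
  · intro k i
    refine prod_nonneg fun k' h => ?_
    have := hdpos (hU h).1
    positivity
  · intro k
    have h1 : ∏ i, g k i = ∏ k' ∈ T k, lam * (1 / (N * wrapNorm (t k - t k'))) :=
      prod_fiberwise _ _ _
    rw [h1, prod_mul_distrib, prod_const]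
    have h2 : 0 ≤ ∏ k' ∈ T k, 1 / (N * wrapNorm (t k - t k')) := prod_nonneg fun k' h => by
      have := hdpos h
      positivity
    gcongr
    · exact hTcard k
    · exact hK k
  · intro k i
    rw [eval_mul, eval_localPoly, sub_self, localKernel_zero h₁ h₂, one_mul, eval_prod]
    refine prod_eq_one fun k' h => ?_
    obtain ⟨h1, h2⟩ := hU h
    apply eval_nodePoly_self
    · rw [h2]
      exact hdle h1
    · rw [h2]
      exact mul_pos hn' (hdpos h1)
  · intro j k hjk hc
    have hj : j ∈ U k (i₀ k j) := mem_filter.2 ⟨mem_filter.2 ⟨mem_univ _, hc, hjk⟩, rfl⟩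
    refine prod_eq_zero (mem_univ (i₀ k j)) ?_
    rw [eval_mul, eval_prod, prod_eq_zero hj (eval_nodePoly_eq_zero _ _ _), mul_zero]
  · intro k i x
    rw [eval_mul, eval_prod, norm_mul, norm_prod, eval_localPoly, mul_comm]
    refine mul_le_mul_of_nonneg_right ?_ (norm_nonneg _)
    refine prod_le_prod (fun _ _ => norm_nonneg _) fun k' h => ?_
    obtain ⟨h1, h2⟩ := hU h
    have h3 := hdpos h1
    have h4 : (lam : ℝ) * (1 / (N * wrapNorm (t k - t k'))) =
        1 / (N * wrapNorm (t k - t k') / lam) := by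
      field_simp
    rw [h4]
    refine norm_eval_nodePoly_le ?_ (by positivity) ?_ x
    · rw [h2]
      exact hdle h1
    · rw [h2, mul_div_assoc', div_le_iff₀ (by positivity)]
      nlinarith

end

/-! ### Duality, the Schur test and entrywise bounds -/

section

open Finset Polynomial ComplexConjugate

variable {d M L N : ℕ} {t : Fin M → Fin d → ℝ}

lemma vandermondeMatrix_apply (j : Fin M) (α : Fin d → Fin N) :
    vandermondeMatrix N t j α = ∏ i, torusChar (t j i) ^ (α i : ℕ) := rfl

/-- The coefficients of the multivariate polynomial `∏ i, p i (z i)`. -/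
noncomputable def tensorCoeff (N : ℕ) (p : Fin d → ℂ[X]) (α : Fin d → Fin N) : ℂ :=
  ∏ i, (p i).coeff (α i)

lemma sum_vandermondeMatrix_mul_tensorCoeff {p : Fin d → ℂ[X]} (hp : ∀ i, (p i).natDegree < N)
    (j : Fin M) : ∑ α, vandermondeMatrix N t j α * tensorCoeff N p α =
      ∏ i, (p i).eval (torusChar (t j i)) := by
  simp only [vandermondeMatrix_apply, tensorCoeff, ← prod_mul_distrib]
  rw [← Fintype.prod_sum
    (f := fun (i : Fin d) (a : Fin N) => torusChar (t j i) ^ (a : ℕ) * (p i).coeff a)]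
  refine prod_congr rfl fun i _ => ?_
  rw [eval_eq_sum_range' (hp i),
    Fin.sum_univ_eq_sum_range fun a => torusChar (t j i) ^ a * (p i).coeff a]
  exact sum_congr rfl fun a _ => mul_comm _ _

lemma sum_tensorCoeff_mul_conj (p q : Fin d → ℂ[X]) :
    ∑ α, tensorCoeff N p α * conj (tensorCoeff N q α) =
      ∏ i, ∑ a ∈ range N, (p i).coeff a * conj ((q i).coeff a) := by
  simp only [tensorCoeff, map_prod, ← prod_mul_distrib]
  rw [← Fintype.prod_sum
    (f := fun (i : Fin d) (a : Fin N) => (p i).coeff a * conj ((q i).coeff a))]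
  exact prod_congr rfl fun i _ =>
    Fin.sum_univ_eq_sum_range (fun a => (p i).coeff a * conj ((q i).coeff a)) N

/-- The Schur test for a symmetric majorant. -/
lemma norm_sum_sum_le_of_symm {ι : Type*} [Fintype ι] {E : ι → ι → ℂ} {g : ι → ι → ℝ} {s : ℝ}
    (hE : ∀ j k, ‖E j k‖ ≤ g j k) (hg : ∀ j k, g j k = g k j) (hs : ∀ j, ∑ k, g j k ≤ s)
    (v : ι → ℂ) : ‖∑ j, ∑ k, conj (v j) * v k * E j k‖ ≤ s * ∑ j, ‖v j‖ ^ 2 := by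
  have h1 : ‖∑ j, ∑ k, conj (v j) * v k * E j k‖ ≤
      ∑ j, ∑ k, (‖v j‖ ^ 2 * g j k + ‖v k‖ ^ 2 * g k j) / 2 := by
    refine norm_sum_le_of_le _ fun j _ => norm_sum_le_of_le _ fun k _ => ?_
    rw [norm_mul, norm_mul, RCLike.norm_conj, ← hg j k]
    have h0 : 0 ≤ g j k := (norm_nonneg _).trans (hE j k)
    calc _ ≤ ‖v j‖ * ‖v k‖ * g j k := by gcongr; exact hE j k
      _ ≤ _ := by nlinarith [mul_nonneg h0 (sq_nonneg (‖v j‖ - ‖v k‖))]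
  have h2 : ∑ j, ∑ k, (‖v j‖ ^ 2 * g j k + ‖v k‖ ^ 2 * g k j) / 2 =
      ∑ j, ‖v j‖ ^ 2 * ∑ k, g j k := by
    simp only [add_div, sum_add_distrib]
    rw [sum_comm (f := fun j k => ‖v k‖ ^ 2 * g k j / 2), ← sum_add_distrib]
    refine sum_congr rfl fun j _ => ?_
    rw [← sum_add_distrib, mul_sum]
    exact sum_congr rfl fun k _ => by ring
  rw [h2] at h1
  refine h1.trans ?_
  rw [mul_sum]
  refine sum_le_sum fun j _ => ?_
  rw [mul_comm]
  gcongr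
  exact hs j

/-- The pairing is the quadratic form of the matrix `P_k(t_j)`, that is, the identity plus a
perturbation that the Schur test bounds by `ε`. -/
lemma one_sub_le_norm_sum_conj_mul {p : Fin M → Fin d → ℂ[X]}
    (hp : ∀ k i, (p k i).natDegree < N) {g : Fin M → Fin M → ℝ} {ε : ℝ}
    (hE : ∀ j k, ‖(∏ i, (p k i).eval (torusChar (t j i))) - if j = k then 1 else 0‖ ≤ g j k)
    (hg : ∀ j k, g j k = g k j) (hs : ∀ j, ∑ k, g j k ≤ ε)
    {v : Fin M → ℂ} (hv : ∑ j, ‖v j‖ ^ 2 = 1) :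
    1 - ε ≤ ‖∑ α, conj (((vandermondeMatrix N t).conjTranspose.mulVec v) α) *
      ∑ k, v k * tensorCoeff N (p k) α‖ := by
  have h1 : ∑ α, conj (((vandermondeMatrix N t).conjTranspose.mulVec v) α) *
      ∑ k, v k * tensorCoeff N (p k) α =
      ∑ j, ∑ k, conj (v j) * v k * ∏ i, (p k i).eval (torusChar (t j i)) := by
    have h2 (α : Fin d → Fin N) : conj (((vandermondeMatrix N t).conjTranspose.mulVec v) α) *
        ∑ k, v k * tensorCoeff N (p k) α = ∑ j, ∑ k, conj (v j) * v k *
          (vandermondeMatrix N t j α * tensorCoeff N (p k) α) := by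
      simp only [Matrix.mulVec, dotProduct, Matrix.conjTranspose_apply, map_sum, map_mul,
        RCLike.star_def, Complex.conj_conj]
      rw [sum_mul_sum]
      refine sum_congr rfl fun j _ => sum_congr rfl fun k _ => ?_
      ring
    simp only [h2]
    rw [sum_comm]
    refine sum_congr rfl fun j _ => ?_
    rw [sum_comm]
    refine sum_congr rfl fun k _ => ?_
    rw [← mul_sum, sum_vandermondeMatrix_mul_tensorCoeff (hp k)]
  have h3 : ∑ j, ∑ k, conj (v j) * v k * ∏ i, (p k i).eval (torusChar (t j i)) = 1 +
      ∑ j, ∑ k, conj (v j) * v k *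
        ((∏ i, (p k i).eval (torusChar (t j i))) - if j = k then 1 else 0) := by
    simp only [mul_sub, sum_sub_distrib, mul_ite, mul_one, mul_zero, sum_ite_eq, mem_univ, if_true]
    have h4 : ∑ j, conj (v j) * v j = 1 := by
      simp only [Complex.conj_mul']
      exact_mod_cast hv
    rw [h4]
    ring
  rw [h1, h3]
  have h5 := norm_sum_sum_le_of_symm hE hg hs v
  rw [hv, mul_one] at h5
  have h6 := norm_sub_le_norm_add (1 : ℂ) (∑ j, ∑ k, conj (v j) * v k *
        ((∏ i, (p k i).eval (torusChar (t j i))) - if j = k then 1 else 0))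
  rw [norm_one] at h6
  linarith

lemma sq_norm_sum_conj_mul_le {ι : Type*} [Fintype ι] (w c : ι → ℂ) :
    ‖∑ α, conj (w α) * c α‖ ^ 2 ≤ (∑ α, ‖w α‖ ^ 2) * ∑ α, ‖c α‖ ^ 2 := by
  have h1 : ‖∑ α, conj (w α) * c α‖ ≤ ∑ α, ‖w α‖ * ‖c α‖ :=
    norm_sum_le_of_le _ fun α _ => by rw [norm_mul, RCLike.norm_conj]
  exact (pow_le_pow_left₀ (norm_nonneg _) h1 2).trans (sum_mul_sq_le_sq_mul_sq _ _ _)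

lemma sum_sq_norm_le {p : Fin M → Fin d → ℂ[X]} {g : Fin M → Fin M → ℝ} {s : ℝ}
    (hE : ∀ j k, ‖∑ α, tensorCoeff N (p j) α * conj (tensorCoeff N (p k) α)‖ ≤ g j k)
    (hg : ∀ j k, g j k = g k j) (hs : ∀ j, ∑ k, g j k ≤ s)
    {v : Fin M → ℂ} (hv : ∑ j, ‖v j‖ ^ 2 = 1) :
    ∑ α, ‖∑ k, v k * tensorCoeff N (p k) α‖ ^ 2 ≤ s := by
  have h1 : ((∑ α, ‖∑ k, v k * tensorCoeff N (p k) α‖ ^ 2 : ℝ) : ℂ) =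
      ∑ j, ∑ k, conj (v j) * v k *
        ∑ α, tensorCoeff N (p k) α * conj (tensorCoeff N (p j) α) := by
    have h2 (α : Fin d → Fin N) : (‖∑ k, v k * tensorCoeff N (p k) α‖ : ℂ) ^ 2 =
        ∑ j, ∑ k, conj (v j) * v k * (tensorCoeff N (p k) α * conj (tensorCoeff N (p j) α)) := by
      rw [← Complex.conj_mul', map_sum, sum_mul_sum]
      refine sum_congr rfl fun j _ => sum_congr rfl fun k _ => ?_
      rw [map_mul]
      ring
    push_cast
    simp only [h2]
    rw [sum_comm]
    refine sum_congr rfl fun j _ => ?_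
    rw [sum_comm]
    exact sum_congr rfl fun k _ => (mul_sum _ _ _).symm
  have h2 := norm_sum_sum_le_of_symm (fun j k => (hE k j).trans_eq (hg k j)) hg hs v
  rw [← h1, hv, mul_one, Complex.norm_real] at h2
  exact (le_abs_self _).trans h2

section

variable {m₁ m₂ β : ℕ} {c : Fin M → Fin L} {G : ℝ} {p : Fin M → Fin d → ℂ[X]}
  {g : Fin M → Fin d → ℝ}

lemma IsLocalLagrange.norm_prod_eval_le (h : IsLocalLagrange N m₁ m₂ β t c G p g)
    (hd : 1 ≤ d) (j k : Fin M) {a b : ℝ} (ha : 0 < a) (hb : 0 < b)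
    (h₁ : a ≤ 2 * m₁ * wrapNorm (t j - t k)) (h₂ : b ≤ 2 * m₂ * wrapNorm (t j - t k)) :
    ‖∏ i, (p k i).eval (torusChar (t j i))‖ ≤ G * (a⁻¹ * b⁻¹ ^ β) := by
  obtain ⟨i₀, hi₀⟩ := exists_distInt_eq_wrapNorm hd (t j - t k)
  rw [← hi₀, Pi.sub_apply] at h₁ h₂
  have h3 : ∏ i, ‖localKernel m₁ m₂ β (t j i - t k i)‖ ≤ a⁻¹ * b⁻¹ ^ β := by
    -- Decay is available only in the coordinate that realizes the distance; the other kernels are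
    -- bounded by `1`.
    rw [← mul_prod_erase univ _ (mem_univ i₀)]
    exact (mul_le_mul (norm_localKernel_le β ha hb h₁ h₂)
      (prod_le_one (fun _ _ => norm_nonneg _) fun _ _ => norm_localKernel_le_one _ _ _ _)
      (prod_nonneg fun _ _ => norm_nonneg _) (by positivity)).trans_eq (mul_one _)
  rw [norm_prod]
  calc _ ≤ ∏ i, g k i * ‖localKernel m₁ m₂ β (t j i - t k i)‖ :=
        prod_le_prod (fun _ _ => norm_nonneg _) fun i _ => h.norm_eval_le k i _
    _ = (∏ i, g k i) * ∏ i, ‖localKernel m₁ m₂ β (t j i - t k i)‖ := prod_mul_distrib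
    _ ≤ G * (a⁻¹ * b⁻¹ ^ β) :=
        mul_le_mul (h.prod_le k) h3 (prod_nonneg fun _ _ => norm_nonneg _)
          ((prod_nonneg fun i _ => h.nonneg k i).trans (h.prod_le k))

lemma IsLocalLagrange.norm_sum_tensorCoeff_le_of_forall
    (h : IsLocalLagrange N m₁ m₂ β t c G p g) (hm : 0 < m₁) (hmN : m₁ ≤ N) (j k : Fin M)
    {b : Fin d → ℝ} (hb : ∀ i x, ‖dirichletKernel m₂ (x - t j i)‖ *
      ‖dirichletKernel m₂ (x - t k i)‖ ≤ b i) :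
    ‖∑ α, tensorCoeff N (p j) α * conj (tensorCoeff N (p k) α)‖ ≤
      G ^ 2 * ((m₁ : ℝ)⁻¹ ^ d * (∏ i, b i) ^ β) := by
  have hb0 (i : Fin d) : 0 ≤ b i := le_trans (by positivity) (hb i 0)
  have hG (k : Fin M) : 0 ≤ ∏ i, g k i := prod_nonneg fun i _ => h.nonneg k i
  rw [sum_tensorCoeff_mul_conj, norm_prod]
  calc _ ≤ ∏ i, g j i * g k i * ((m₁ : ℝ)⁻¹ * b i ^ β) :=
        prod_le_prod (fun _ _ => norm_nonneg _) fun i _ =>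
          norm_sum_coeff_mul_conj_le hm hmN (h.natDegree_lt j i) (h.natDegree_lt k i)
            (h.nonneg j i) (h.nonneg k i) (h.norm_eval_le j i) (h.norm_eval_le k i) (hb i)
    _ = (∏ i, g j i) * (∏ i, g k i) * ((m₁ : ℝ)⁻¹ ^ d * (∏ i, b i) ^ β) := by
        simp only [prod_mul_distrib, prod_const, card_univ, Fintype.card_fin, prod_pow]
    _ ≤ G * G * ((m₁ : ℝ)⁻¹ ^ d * (∏ i, b i) ^ β) := by
        have := prod_nonneg fun i (_ : i ∈ univ) => hb0 i
        gcongr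
        · exact hG k
        · exact (hG j).trans (h.prod_le j)
        · exact h.prod_le j
        · exact h.prod_le k
    _ = _ := by ring

lemma IsLocalLagrange.norm_sum_tensorCoeff_le
    (h : IsLocalLagrange N m₁ m₂ β t c G p g) (hm : 0 < m₁) (hmN : m₁ ≤ N) (j k : Fin M) :
    ‖∑ α, tensorCoeff N (p j) α * conj (tensorCoeff N (p k) α)‖ ≤ G ^ 2 * (m₁ : ℝ)⁻¹ ^ d := by
  have := h.norm_sum_tensorCoeff_le_of_forall hm hmN j k (b := fun _ => 1) fun i x =>
    mul_le_one₀ (norm_dirichletKernel_le_one _ _) (norm_nonneg _)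
      (norm_dirichletKernel_le_one _ _)
  simpa using this

lemma IsLocalLagrange.norm_sum_tensorCoeff_le_of_le_wrapNorm
    (h : IsLocalLagrange N m₁ m₂ β t c G p g) (hd : 1 ≤ d) (hm : 0 < m₁) (hmN : m₁ ≤ N)
    (j k : Fin M) {a : ℝ} (ha : 0 < a) (hak : a ≤ m₂ * wrapNorm (t j - t k)) :
    ‖∑ α, tensorCoeff N (p j) α * conj (tensorCoeff N (p k) α)‖ ≤
      G ^ 2 * (m₁ : ℝ)⁻¹ ^ d * a⁻¹ ^ β := by
  obtain ⟨i₀, hi₀⟩ := exists_distInt_eq_wrapNorm hd (t j - t k)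
  rw [← hi₀, Pi.sub_apply] at hak
  have := h.norm_sum_tensorCoeff_le_of_forall hm hmN j k
    (b := fun i => if i = i₀ then a⁻¹ else 1) fun i x => by
      split_ifs with hi
      · subst hi
        exact norm_dirichletKernel_mul_dirichletKernel_le ha hak
      · exact mul_le_one₀ (norm_dirichletKernel_le_one _ _) (norm_nonneg _)
          (norm_dirichletKernel_le_one _ _)
  rw [prod_ite_eq' univ i₀, if_pos (mem_univ _)] at this
  rwa [mul_assoc]

end

lemma norm_tensorCoeff_localPoly_sum_le {m₁ m₂ β : ℕ} (v : Fin M → ℂ) (α : Fin d → Fin N) :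
    ‖∑ k, v k * tensorCoeff N (fun i => localPoly m₁ m₂ β (t k i)) α‖ ≤
      (m₁ : ℝ)⁻¹ ^ d * ‖((vandermondeMatrix N t).conjTranspose.mulVec v) α‖ := by
  have h : ∑ k, v k * tensorCoeff N (fun i => localPoly m₁ m₂ β (t k i)) α =
      (∏ i, (localPoly m₁ m₂ β 0).coeff (α i)) *
        ((vandermondeMatrix N t).conjTranspose.mulVec v) α := by
    simp only [Matrix.mulVec, dotProduct, Matrix.conjTranspose_apply, vandermondeMatrix_apply,
      tensorCoeff, mul_sum, RCLike.star_def]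
    refine sum_congr rfl fun k _ => ?_
    rw [prod_congr rfl fun i _ => coeff_localPoly m₁ m₂ β (t k i) (α i), prod_mul_distrib,
      map_prod]
    ring
  rw [h, norm_mul, norm_prod]
  gcongr
  calc _ ≤ ∏ _i : Fin d, (m₁ : ℝ)⁻¹ :=
        prod_le_prod (fun _ _ => norm_nonneg _) fun i _ => norm_coeff_localPoly_le _ _ _ _ _
    _ = _ := by simp

/-- The packing bound rescaled from separation `R` to length `b`. The separation hypothesis enters
here, with `b = λβ` and `Y = √β λ^λ C`. -/
lemma sum_pow_div_wrapNorm_le (hd : 1 ≤ d) {β lam : ℕ} (hβ : d + 1 ≤ β) (hN : 0 < N)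
    {c : Fin M → Fin L} (hcard : ∀ l, #{k | c k = l} ≤ lam) {R b Y : ℝ} (hR : 0 < R)
    (hb : 0 ≤ b) (hY : 0 < Y)
    (hsep : ∀ j k, c j ≠ c k → R ≤ N * wrapNorm (t j - t k))
    (hRb : b ^ β * (2 ^ d * (2 ^ d - 1) * (∑' n : ℕ, 1 / (n : ℝ) ^ (β - d + 1)) * Y) ≤ R ^ β)
    (j : Fin M) :
    ∑ k with c k ≠ c j, (b / (N * wrapNorm (t j - t k))) ^ β ≤ lam / Y := by
  have hN' : (0 : ℝ) < N := by exact_mod_cast hN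
  set ζ := ∑' n : ℕ, 1 / (n : ℝ) ^ (β - d + 1)
  have h1 := sum_div_wrapNorm_pow_le hd {k | c k ≠ c j} t (t j) c (δ := R / N) (by positivity)
    (lam := lam) hβ (fun k hk => by
      rw [div_le_iff₀' hN']
      exact hsep k j (mem_filter.1 hk).2)
    (fun a _ b _ hab => by
      rw [div_le_iff₀' hN']
      exact hsep a b hab)
    (fun a _ => (card_le_card (filter_subset_filter _ (subset_univ _))).trans (hcard (c a)))
  have h2 : ∑ k with c k ≠ c j, (b / (N * wrapNorm (t j - t k))) ^ β =
      (b ^ β / R ^ β) * ∑ k with c k ≠ c j, (R / N / wrapNorm (t k - t j)) ^ β := by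
    rw [mul_sum]
    refine sum_congr rfl fun k _ => ?_
    rw [wrapNorm_sub_comm hd (t k), ← div_pow, ← mul_pow]
    congr 1
    field_simp
  rw [h2]
  calc _ ≤ (b ^ β / R ^ β) * (lam * (2 ^ d * (2 ^ d - 1)) * ζ) := by gcongr
    _ = lam * (b ^ β * (2 ^ d * (2 ^ d - 1) * ζ)) / R ^ β := by ring
    _ ≤ lam / Y := by
      rw [div_le_div_iff₀ (by positivity) hY]
      calc _ = lam * (b ^ β * (2 ^ d * (2 ^ d - 1) * ζ * Y)) := by ring
        _ ≤ _ := by gcongr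

end

/-! ### Row sums of the error matrix and of the Gram matrix -/

section

open Finset Polynomial ComplexConjugate

variable {d M L N : ℕ} {t : Fin M → Fin d → ℝ}

section

variable {m₁ m₂ β lam : ℕ} {c : Fin M → Fin L} {C : ℝ} {p : Fin M → Fin d → ℂ[X]}
  {g : Fin M → Fin d → ℝ}

/-- Within a cluster the interpolation is exact, so only other clusters contribute. `D_{m₁}` yields
the factor `1/β`, and `D_{m₂}` the decay with an extra `τ^(-β)`. The parameter `τ` is `1` for
isolated nodes and `2` for genuine clusters. -/
lemma IsLocalLagrange.one_sub_le
    (h : IsLocalLagrange N m₁ m₂ β t c ((lam : ℝ) ^ (lam - 1) * C) p g)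
    (hd : 1 ≤ d) (hβ : 0 < β) (hlam : 0 < lam) (hN : 0 < N) (hC : 0 < C) {τ : ℝ} (hτ : 0 < τ)
    (hpos : ∀ j k, j ≠ k → 0 < wrapNorm (t j - t k))
    (h₁ : ∀ j k, c j ≠ c k → (β : ℝ) ≤ 2 * m₁ * wrapNorm (t j - t k))
    (h₂ : τ * N / (lam * β) ≤ 2 * m₂)
    (hrow : ∀ j, ∑ k with c k ≠ c j, (lam * β / (N * wrapNorm (t j - t k))) ^ β ≤
      lam / (√β * (lam : ℝ) ^ lam * C))
    {v : Fin M → ℂ} (hv : ∑ j, ‖v j‖ ^ 2 = 1) :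
    1 - 1 / (β * √β * τ ^ β) ≤
      ‖∑ α, conj (((vandermondeMatrix N t).conjTranspose.mulVec v) α) *
        ∑ k, v k * tensorCoeff N (p k) α‖ := by
  have hβ' : (0 : ℝ) < β := by exact_mod_cast hβ
  have hN' : (0 : ℝ) < N := by exact_mod_cast hN
  have hlam' : (0 : ℝ) < lam := by exact_mod_cast hlam
  have hs : 0 < √(β : ℝ) := Real.sqrt_pos.2 hβ'
  let u : Fin M → Fin M → ℝ := fun j k => (lam * β / (N * wrapNorm (t j - t k))) ^ β
  let κ : ℝ := (lam : ℝ) ^ (lam - 1) * C * ((β : ℝ)⁻¹ * (τ ^ β)⁻¹)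
  refine one_sub_le_norm_sum_conj_mul h.natDegree_lt
    (g := fun j k => if c k ≠ c j then κ * u j k else 0) (fun j k => ?_) (fun j k => ?_)
    (fun j => ?_) hv
  · split_ifs with hjk hck hck
    · exact absurd (congrArg c hjk).symm hck
    · subst hjk
      simp [h.eval_self]
    · have hW := hpos j k hjk
      rw [sub_zero]
      refine (h.norm_prod_eval_le hd j k hβ' (b := τ * N / (lam * β) * wrapNorm (t j - t k))
        (by positivity) (h₁ j k (Ne.symm hck)) (by gcongr)).trans_eq ?_
      have : (τ * N / (lam * β) * wrapNorm (t j - t k))⁻¹ =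
          τ⁻¹ * (lam * β / (N * wrapNorm (t j - t k))) := by
        field_simp
      rw [this, mul_pow, inv_pow]
      simp only [κ, u]
      ring
    · rw [h.prod_eval_eq_zero j k hjk (not_not.1 hck).symm, sub_zero, norm_zero]
  · simp only [u, wrapNorm_sub_comm hd (t j), ne_comm (a := c j)]
  · rw [← sum_filter, ← mul_sum]
    calc κ * ∑ k with c k ≠ c j, u j k ≤ κ * (lam / (√β * (lam : ℝ) ^ lam * C)) := by
          gcongr
          exact hrow j
      _ = 1 / (β * √β * τ ^ β) := by
          obtain ⟨l, rfl⟩ : ∃ l, lam = l + 1 := ⟨lam - 1, by omega⟩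
          simp only [κ, Nat.add_sub_cancel, pow_succ]
          field_simp

/-- A Gram row has at most `lam` entries from its own cluster, which give the `1`. The other
clusters give `1/(4√β)`, because `lam ^ lam ≥ 4` and `C ≥ 1`. -/
lemma IsLocalLagrange.sum_sq_norm_le
    (h : IsLocalLagrange N m₁ m₂ β t c ((lam : ℝ) ^ (lam - 1) * C) p g)
    (hd : 1 ≤ d) (hβ : 0 < β) (hlam : 2 ≤ lam) (hC : 1 ≤ C)
    (hm : 0 < m₁) (hmN : m₁ ≤ N) (hcard : ∀ l, #{k | c k = l} ≤ lam)
    (hpos : ∀ j k, j ≠ k → 0 < wrapNorm (t j - t k))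
    (h₁ : (N : ℝ) / (2 * lam) ≤ m₁) (h₂ : (N : ℝ) / (lam * β) ≤ m₂)
    (hrow : ∀ j, ∑ k with c k ≠ c j, (lam * β / (N * wrapNorm (t j - t k))) ^ β ≤
      lam / (√β * (lam : ℝ) ^ lam * C))
    {v : Fin M → ℂ} (hv : ∑ j, ‖v j‖ ^ 2 = 1) :
    ∑ α, ‖∑ k, v k * tensorCoeff N (p k) α‖ ^ 2 ≤
      (2 * lam / N) ^ d * (lam * ((lam : ℝ) ^ (lam - 1) * C) ^ 2) * (1 + 1 / (4 * √β)) := by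
  have hβ' : (0 : ℝ) < β := by exact_mod_cast hβ
  have hN' : (0 : ℝ) < N := by exact_mod_cast hm.trans_le hmN
  have hlam' : (2 : ℝ) ≤ lam := by exact_mod_cast hlam
  have hs : 0 < √(β : ℝ) := Real.sqrt_pos.2 hβ'
  set G := (lam : ℝ) ^ (lam - 1) * C
  let u : Fin M → Fin M → ℝ := fun j k => (lam * β / (N * wrapNorm (t j - t k))) ^ β
  let κ : ℝ := G ^ 2 * (m₁ : ℝ)⁻¹ ^ d
  have hκ : κ ≤ G ^ 2 * (2 * lam / N) ^ d := by
    have : (m₁ : ℝ)⁻¹ ≤ 2 * lam / N := by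
      rw [← inv_div]
      exact inv_anti₀ (by positivity) h₁
    simp only [κ]
    gcongr
  refine _root_.sum_sq_norm_le
    (g := fun j k => if c k ≠ c j then κ * u j k else κ) (fun j k => ?_) (fun j k => ?_)
    (fun j => ?_) hv
  · split_ifs with hck
    · have hW := hpos j k fun h => hck (congrArg c h).symm
      refine (h.norm_sum_tensorCoeff_le_of_le_wrapNorm hd hm hmN j k
        (a := N / (lam * β) * wrapNorm (t j - t k)) (by positivity) (by gcongr)).trans_eq ?_
      have : (N / (lam * β) * wrapNorm (t j - t k))⁻¹ =
          lam * β / (N * wrapNorm (t j - t k)) := by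
        field_simp
      rw [this]
    · exact h.norm_sum_tensorCoeff_le hm hmN j k
  · simp only [u, wrapNorm_sub_comm hd (t j), ne_comm (a := c j)]
  · have h3 : (#{k | ¬ c k ≠ c j} : ℝ) ≤ lam := by
      simp only [not_not]
      exact_mod_cast hcard (c j)
    have h4 : (4 : ℝ) ≤ (lam : ℝ) ^ lam := by
      calc (4 : ℝ) = 2 ^ 2 := by norm_num
        _ ≤ (lam : ℝ) ^ 2 := by gcongr
        _ ≤ (lam : ℝ) ^ lam := pow_le_pow_right₀ (by linarith) hlam
    have h5 : lam / (√β * (lam : ℝ) ^ lam * C) ≤ lam / (√β * 4 * 1) := by gcongr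
    rw [sum_ite, ← mul_sum, sum_const, nsmul_eq_mul]
    calc _ ≤ κ * (lam / (√β * 4 * 1)) + lam * κ := by
          gcongr
          exact (hrow j).trans h5
      _ = κ * (lam * (1 + 1 / (4 * √β))) := by ring
      _ ≤ (G ^ 2 * (2 * lam / N) ^ d) * (lam * (1 + 1 / (4 * √β))) := by gcongr
      _ = _ := by ring

end

/-! ### Numerical constants -/

lemma sqrt_two_bounds : 1.414 ≤ √(2 : ℝ) ∧ √(2 : ℝ) ≤ 1.415 :=
  ⟨Real.le_sqrt_of_sq_le (by norm_num), Real.sqrt_le_iff.2 (by norm_num)⟩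

lemma eq_two_or_four_le {β : ℕ} (hd : 1 ≤ d) (hβ : d + 1 ≤ β) (he : Even β) :
    (β = 2 ∧ d = 1) ∨ 4 ≤ β := by
  obtain ⟨r, rfl⟩ := he
  omega

lemma two_div_sqrt_pow_le_one {β : ℕ} (hβ : 4 ≤ β) : (2 / √(β : ℝ)) ^ d ≤ 1 := by
  have h : 2 ≤ √(β : ℝ) := Real.le_sqrt_of_sq_le (by norm_num; exact_mod_cast hβ)
  exact pow_le_one₀ (by positivity) ((div_le_one (by linarith)).2 h)

/-- The constant `2.25 = 1.5²` is nearly used up at `β = 2`, `d = 1`, where the two sides are about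
`1.414` and `1.454`. For `β ≥ 4` the left side is at most `1`. -/
lemma two_div_sqrt_pow_le {β : ℕ} (hd : 1 ≤ d) (hβ : d + 1 ≤ β) (he : Even β) :
    (2 / √(β : ℝ)) ^ d ≤ 2.25 * (1 - 1 / (β * √β * 1 ^ β)) := by
  rcases eq_two_or_four_le hd hβ he with ⟨rfl, rfl⟩ | h4
  · have h := sqrt_two_bounds
    have h2 : √(2 : ℝ) ^ 2 = 2 := Real.sq_sqrt (by norm_num)
    push_cast
    have h3 : 2 / √(2 : ℝ) = √2 := by rw [div_eq_iff (by linarith)]; linarith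
    have h5 : 1 / (2 * √(2 : ℝ) * 1 ^ 2) ≤ 1 / (2 * 1.414 * 1 ^ 2) := by
      gcongr
      exact h.1
    rw [pow_one, h3]
    norm_num at h5 h ⊢
    linarith
  · have h : 2 ≤ √(β : ℝ) := Real.le_sqrt_of_sq_le (by norm_num; exact_mod_cast h4)
    have h4' : (4 : ℝ) ≤ β := by exact_mod_cast h4
    have h5 : 1 / (β * √β * 1 ^ β) ≤ 1 / (4 * 2 * 1 : ℝ) := by
      rw [one_pow]
      gcongr
    have := two_div_sqrt_pow_le_one (d := d) h4
    norm_num at h5 ⊢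
    linarith

lemma two_div_sqrt_pow_mul_le {β : ℕ} (hd : 1 ≤ d) (hβ : d + 1 ≤ β) (he : Even β) :
    (2 / √(β : ℝ)) ^ d * (1 + 1 / (4 * √β)) ≤ 2.25 * (1 - 1 / (β * √β * 2 ^ β)) ^ 2 := by
  rcases eq_two_or_four_le hd hβ he with ⟨rfl, rfl⟩ | h4
  · have h := sqrt_two_bounds
    have h2 : √(2 : ℝ) ^ 2 = 2 := Real.sq_sqrt (by norm_num)
    push_cast
    have h3 : 2 / √(2 : ℝ) * (1 + 1 / (4 * √2)) = √2 + 1 / 4 := by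
      have : √(2 : ℝ) ≠ 0 := by linarith
      field_simp
      nlinarith
    have h5 : 1 / (2 * √(2 : ℝ) * 2 ^ 2) ≤ 1 / (2 * 1.414 * 2 ^ 2) := by
      gcongr
      exact h.1
    have h6 : 0.91 ≤ 1 - 1 / (2 * √(2 : ℝ) * 2 ^ 2) := by
      norm_num at h5 ⊢
      linarith
    rw [pow_one, h3]
    nlinarith
  · have h : 2 ≤ √(β : ℝ) := Real.le_sqrt_of_sq_le (by norm_num; exact_mod_cast h4)
    have h4' : (4 : ℝ) ≤ β := by exact_mod_cast h4
    have h5 : 1 / (β * √β * 2 ^ β) ≤ 1 / (4 * 2 * 1 : ℝ) := by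
      gcongr
      exact one_le_pow₀ (by norm_num)
    have h6 : 1 / (4 * √(β : ℝ)) ≤ 1 / (4 * 2) := by gcongr
    have h7 := two_div_sqrt_pow_le_one (d := d) h4
    have h8 : 7 / 8 ≤ 1 - 1 / (β * √(β : ℝ) * 2 ^ β) := by
      norm_num at h5 ⊢
      linarith
    have h9 : (2 / √(β : ℝ)) ^ d * (1 + 1 / (4 * √β)) ≤ 1 * (1 + 1 / (4 * 2)) := by gcongr
    nlinarith

/-- The square of the claimed bound times the main term of the Gram bound: the powers of `N`, `λ`
and `C` cancel, which leaves a comparison in `β` and `d` alone. -/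
lemma lower_bound_sq_mul {β lam : ℕ} (hβ : 0 < β) (hlam : 0 < lam) (hN : 0 < N) {C : ℝ}
    (hC : 0 < C) :
    ((1.5 * (β : ℝ) ^ ((d : ℝ) / 4) * (lam : ℝ) ^ ((lam : ℝ) + (d : ℝ) / 2 - 1 / 2))⁻¹ *
        ((N : ℝ) ^ ((d : ℝ) / 2) / C)) ^ 2 *
      ((2 * lam / N) ^ d * (lam * ((lam : ℝ) ^ (lam - 1) * C) ^ 2)) =
      (2 / √(β : ℝ)) ^ d / 2.25 := by
  have hβ' : (0 : ℝ) < β := by exact_mod_cast hβ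
  have hN' : (0 : ℝ) < N := by exact_mod_cast hN
  have hlam' : (0 : ℝ) < lam := by exact_mod_cast hlam
  have h1 : ((β : ℝ) ^ ((d : ℝ) / 4)) ^ 2 = √(β : ℝ) ^ d := by
    rw [Real.sqrt_eq_rpow, ← Real.rpow_natCast, ← Real.rpow_mul hβ'.le, ← Real.rpow_natCast,
      ← Real.rpow_mul hβ'.le]
    congr 1
    push_cast
    ring
  have h2 : ((lam : ℝ) ^ ((lam : ℝ) + (d : ℝ) / 2 - 1 / 2)) ^ 2 =
      lam * ((lam : ℝ) ^ (lam - 1)) ^ 2 * (lam : ℝ) ^ d := by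
    have h3 : (lam : ℝ) * ((lam : ℝ) ^ (lam - 1)) ^ 2 * (lam : ℝ) ^ d =
        (lam : ℝ) ^ (1 + (lam - 1) * 2 + d) := by
      rw [pow_add, pow_add, pow_mul, pow_one]
    rw [h3, ← Real.rpow_natCast, ← Real.rpow_natCast, ← Real.rpow_mul hlam'.le]
    congr 1
    push_cast [Nat.cast_sub hlam]
    ring
  have h4 : ((N : ℝ) ^ ((d : ℝ) / 2)) ^ 2 = (N : ℝ) ^ d := by
    rw [← Real.rpow_natCast, ← Real.rpow_natCast, ← Real.rpow_mul hN'.le]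
    congr 1
    push_cast
    ring
  have hs : 0 < √(β : ℝ) := Real.sqrt_pos.2 hβ'
  rw [mul_pow, inv_pow, mul_pow, mul_pow, div_pow, h1, h2, h4, div_pow, div_pow, mul_pow]
  field_simp
  norm_num

end

/-! ### Choice of degrees and the two cases -/

section

open Finset

variable {d M L N : ℕ} {t : Fin M → Fin d → ℝ} {Λ : Fin L → Finset (Fin d → ℝ)}

lemma le_sigmaMin {m n : Type*} [Fintype m] [DecidableEq m] [Nonempty m] [Fintype n]
    {A : Matrix m n ℂ} {b : ℝ}
    (h : ∀ v : m → ℂ, ∑ j, ‖v j‖ ^ 2 = 1 → b ^ 2 ≤ ∑ α, ‖A.conjTranspose.mulVec v α‖ ^ 2) :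
    b ≤ sigmaMin A := by
  obtain ⟨j⟩ := ‹Nonempty m›
  have : Nonempty {v : EuclideanSpace ℂ m // ‖v‖ = 1} :=
    ⟨⟨EuclideanSpace.single j 1, by simp⟩⟩
  refine le_ciInf fun v => ?_
  refine le_of_sq_le_sq ?_ (norm_nonneg _)
  rw [EuclideanSpace.norm_sq_eq]
  refine h _ ?_
  have := EuclideanSpace.norm_sq_eq v.1
  rw [v.2, one_pow] at this
  exact this.symm

lemma lt_of_div_add_one {a b : ℕ} (hb : 0 < b) : a ≤ b * ((a - 1) / b + 1) := by
  have := Nat.lt_mul_div_succ (a - 1) hb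
  omega

lemma natCast_div_le {a b m : ℕ} (hb : 0 < b) (h : a ≤ b * m) : (a : ℝ) / b ≤ m := by
  rw [div_le_iff₀' (by exact_mod_cast hb)]
  exact_mod_cast h

/-- Without Lagrange factors, the coefficient vector is entrywise at most `(2/N)^d |A* v|`. The
pairing is therefore at most `(2/N)^d ‖A* v‖²`, so `1 - ε` enters to the first power only. -/
lemma sq_le_sum_of_isolated {β : ℕ} (hd : 1 ≤ d) (hβ : d + 1 ≤ β) (he : Even β) (hN : 0 < N)
    {c : Fin M → Fin L} (hc : Function.Injective c) {C : ℝ} (hC : 1 ≤ C)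
    (hpos : ∀ j k, j ≠ k → 0 < wrapNorm (t j - t k))
    (hsep : ∀ j k, c j ≠ c k → (β : ℝ) ≤ N * wrapNorm (t j - t k))
    (hrow : ∀ j, ∑ k with c k ≠ c j, ((1 : ℕ) * β / (N * wrapNorm (t j - t k))) ^ β ≤
      (1 : ℕ) / (√β * ((1 : ℕ) : ℝ) ^ 1 * C))
    {b : ℝ} (hb : b ^ 2 * ((2 * (1 : ℕ) / N) ^ d * ((1 : ℕ) * (((1 : ℕ) : ℝ) ^ (1 - 1) * C) ^ 2)) =
      (2 / √(β : ℝ)) ^ d / 2.25)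
    {v : Fin M → ℂ} (hv : ∑ j, ‖v j‖ ^ 2 = 1) :
    b ^ 2 ≤ ∑ α, ‖((vandermondeMatrix N t).conjTranspose.mulVec v) α‖ ^ 2 := by
  have hβ0 : 0 < β := by omega
  have hN' : (0 : ℝ) < N := by exact_mod_cast hN
  -- These are the ceilings of `N/2` and `N/(2β)`; the degrees `m₁ - 1` and `β (m₂ - 1)` each use at
  -- most half of `N - 1`.
  obtain ⟨m₁, hm₁⟩ : ∃ m, m = (N - 1) / 2 + 1 := ⟨_, rfl⟩
  obtain ⟨m₂, hm₂⟩ : ∃ m, m = (N - 1) / (2 * β) + 1 := ⟨_, rfl⟩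
  have hN₁ : N ≤ 2 * m₁ := by omega
  have hN₂ : N ≤ 2 * β * m₂ := hm₂ ▸ lt_of_div_add_one (by omega)
  have hdeg : (m₁ - 1) + β * (m₂ - 1) < N := by
    have h1 : 2 * β * ((N - 1) / (2 * β)) ≤ N - 1 := Nat.mul_div_le _ _
    rw [← Nat.add_sub_cancel (n := (N - 1) / (2 * β)) (m := 1), ← hm₂, mul_assoc] at h1
    omega
  have hN₁' : (N : ℝ) ≤ 2 * m₁ := by exact_mod_cast hN₁
  have h := isLocalLagrange_localPoly (t := t) (m₁ := m₁) (m₂ := m₂)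
    (by omega) (hm₂ ▸ Nat.succ_ne_zero _) hdeg hc
    (G := ((1 : ℕ) : ℝ) ^ (1 - 1) * C) (by simpa using hC)
  have h1 := h.one_sub_le hd hβ0 one_pos hN (by linarith) one_pos hpos
    (fun j k hjk => (hsep j k hjk).trans (by gcongr; exact wrapNorm_nonneg _)) (by
      rw [one_mul, Nat.cast_one, one_mul]
      rw [div_le_iff₀ (by exact_mod_cast hβ0)]
      have : (N : ℝ) ≤ 2 * β * m₂ := by exact_mod_cast hN₂
      linarith) hrow hv
  set w := (vandermondeMatrix N t).conjTranspose.mulVec v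
  have h2 : 1 - 1 / (β * √β * 1 ^ β) ≤ (2 / N) ^ d * ∑ α, ‖w α‖ ^ 2 := by
    refine h1.trans ?_
    rw [mul_sum]
    refine norm_sum_le_of_le _ fun α _ => ?_
    rw [norm_mul, RCLike.norm_conj]
    have h3 := norm_tensorCoeff_localPoly_sum_le (t := t) (m₁ := m₁) (m₂ := m₂) (β := β) v α
    have h4 : (m₁ : ℝ)⁻¹ ≤ 2 / N := by
      rw [← inv_div]
      exact inv_anti₀ (by positivity) (by linarith)
    calc _ ≤ ‖w α‖ * ((m₁ : ℝ)⁻¹ ^ d * ‖w α‖) := by gcongr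
      _ ≤ ‖w α‖ * ((2 / N) ^ d * ‖w α‖) := by gcongr
      _ = _ := by ring
  have h5 := two_div_sqrt_pow_le hd hβ he
  have hb' : b ^ 2 * (2 / N) ^ d * C ^ 2 = (2 / √(β : ℝ)) ^ d / 2.25 := by
    rw [← hb]
    simp
    ring
  have h6 : b ^ 2 * (2 / N) ^ d ≤ (2 / √(β : ℝ)) ^ d / 2.25 := by
    rw [← hb']
    exact le_mul_of_one_le_right (by positivity) (one_le_pow₀ hC)
  refine le_of_mul_le_mul_right ?_ (by positivity : (0 : ℝ) < (2 / N) ^ d)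
  rw [mul_comm (∑ α, _)]
  refine h6.trans (le_trans ?_ h2)
  rw [div_le_iff₀ (by norm_num)]
  linarith

/-- Up to rounding, the degree is `N (1/(2λ) + 1/λ + 3(λ-1)/(8λ)) = N (3/8 + 9/(8λ))`, at most
`15N/16` for `λ ≥ 2`. The slack and `N > 8λ` absorb the rounding up to `n + 1`. -/
lemma clustered_degree_lt {lam A B n N : ℕ} (hlam : 2 ≤ lam) (hN : 8 * lam < N)
    (hA : 2 * lam * A ≤ N - 1) (hB : lam * B ≤ N - 1) (hn : 8 * lam * n ≤ 3 * N - 1) :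
    A + B + (lam - 1) * (n + 1) < N := by
  obtain ⟨l, rfl⟩ : ∃ l, lam = l + 2 := ⟨lam - 2, by omega⟩
  obtain ⟨r, rfl⟩ : ∃ r, N = 8 * (l + 2) + 1 + r := ⟨N - (8 * (l + 2) + 1), by omega⟩
  have e : l + 2 - 1 = l + 1 := by omega
  rw [e]
  have hA' : 2 * (l + 2) * A ≤ 8 * (l + 2) + r := by omega
  have hB' : (l + 2) * B ≤ 8 * (l + 2) + r := by omega
  have hn' : 8 * (l + 2) * n ≤ 24 * (l + 2) + 2 + 3 * r := by omega
  have h : 8 * (l + 2) * (A + B + (l + 1) * (n + 1)) <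
      8 * (l + 2) * (8 * (l + 2) + 1 + r) := by
    calc 8 * (l + 2) * (A + B + (l + 1) * (n + 1)) =
          4 * (2 * (l + 2) * A) + 8 * ((l + 2) * B) + (l + 1) * (8 * (l + 2) * n) +
            8 * (l + 2) * (l + 1) := by ring
      _ ≤ 4 * (8 * (l + 2) + r) + 8 * (8 * (l + 2) + r) + (l + 1) * (24 * (l + 2) + 2 + 3 * r) +
            8 * (l + 2) * (l + 1) := by gcongr
      _ < _ := by nlinarith [Nat.zero_le (l * r), Nat.zero_le (l * l)]
  exact lt_of_mul_lt_mul_left h (Nat.zero_le _)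

lemma sq_le_sum_of_clustered {β lam : ℕ} (hd : 1 ≤ d) (hβ : d + 1 ≤ β) (he : Even β)
    (hlam : 2 ≤ lam) (hN : 8 * lam < N)
    {c : Fin M → Fin L} (hcard : ∀ l, #{k | c k = l} ≤ lam) {C : ℝ} (hC : 1 ≤ C)
    (hK : ∀ k, ∏ k' ∈ univ.filter (fun k' => c k' = c k ∧ k' ≠ k),
      1 / (N * wrapNorm (t k - t k')) ≤ C)
    (hpos : ∀ j k, j ≠ k → 0 < wrapNorm (t j - t k))
    (hle : ∀ j k, c j = c k → wrapNorm (t j - t k) ≤ 1 / N)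
    (hsep : ∀ j k, c j ≠ c k → (lam * β : ℝ) ≤ N * wrapNorm (t j - t k))
    (hrow : ∀ j, ∑ k with c k ≠ c j, (lam * β / (N * wrapNorm (t j - t k))) ^ β ≤
      lam / (√β * (lam : ℝ) ^ lam * C))
    {b : ℝ} (hb : b ^ 2 * ((2 * lam / N) ^ d * (lam * ((lam : ℝ) ^ (lam - 1) * C) ^ 2)) =
      (2 / √(β : ℝ)) ^ d / 2.25)
    {v : Fin M → ℂ} (hv : ∑ j, ‖v j‖ ^ 2 = 1) :
    b ^ 2 ≤ ∑ α, ‖((vandermondeMatrix N t).conjTranspose.mulVec v) α‖ ^ 2 := by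
  have hβ0 : 0 < β := by omega
  have hβ' : (0 : ℝ) < β := by exact_mod_cast hβ0
  have hlam0 : 0 < lam := by omega
  have hlam' : (0 : ℝ) < lam := by exact_mod_cast hlam0
  have hN0 : 0 < N := by omega
  have hN' : (0 : ℝ) < N := by exact_mod_cast hN0
  obtain ⟨A, hA⟩ : ∃ m, m = (N - 1) / (2 * lam) := ⟨_, rfl⟩
  obtain ⟨B, hB⟩ : ∃ m, m = (N - 1) / (lam * β) := ⟨_, rfl⟩
  obtain ⟨n, hn⟩ : ∃ n, n = (3 * N - 1) / (8 * lam) := ⟨_, rfl⟩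
  have hA₁ : 2 * lam * A ≤ N - 1 := hA ▸ Nat.mul_div_le _ _
  have hB₁ : lam * (β * B) ≤ N - 1 := by
    rw [← mul_assoc]
    exact hB ▸ Nat.mul_div_le _ _
  have hn₁ : 8 * lam * n ≤ 3 * N - 1 := hn ▸ Nat.mul_div_le _ _
  have hA₂ : N ≤ 2 * lam * (A + 1) := hA ▸ lt_of_div_add_one (by omega)
  have hB₂ : N ≤ lam * β * (B + 1) := hB ▸ lt_of_div_add_one (by positivity)
  have hn₂ : 3 * N ≤ 8 * lam * (n + 1) := hn ▸ lt_of_div_add_one (by omega)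
  have hdeg := clustered_degree_lt hlam hN hA₁ hB₁ hn₁
  have hnN : 4 * (n + 1) ≤ N := by
    have : 16 * n ≤ 8 * lam * n := Nat.mul_le_mul_right _ (by omega)
    omega
  have hAN : A + 1 ≤ N := by omega
  obtain ⟨p, g, h⟩ := exists_isLocalLagrange hd (m₁ := A + 1) (m₂ := B + 1) (β := β)
    (Nat.succ_ne_zero A) (Nat.succ_ne_zero B) (Nat.succ_pos n) hlam0
    (by simpa using hdeg) hnN (by rwa [← mul_assoc]) hcard hpos hle hK
  have h₁ : (N : ℝ) / (2 * lam) ≤ (A + 1 : ℕ) := by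
    exact_mod_cast natCast_div_le (by positivity) hA₂
  have h₂ : (N : ℝ) / (lam * β) ≤ (B + 1 : ℕ) := by
    exact_mod_cast natCast_div_le (by positivity) hB₂
  have h1 := h.one_sub_le hd hβ0 hlam0 hN0 (by linarith) two_pos hpos
    (fun j k hjk => by
      have h3 := hsep j k hjk
      have h4 := wrapNorm_nonneg (t j - t k)
      calc (β : ℝ) = lam * β / lam := by field_simp
        _ ≤ N * wrapNorm (t j - t k) / lam := by gcongr
        _ = 2 * (N / (2 * lam)) * wrapNorm (t j - t k) := by field_simp
        _ ≤ _ := by gcongr)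
    (by rw [mul_div_assoc]; gcongr) hrow hv
  have h2 := h.sum_sq_norm_le hd hβ0 hlam hC (Nat.succ_pos A) hAN hcard hpos h₁ h₂ hrow hv
  set w := (vandermondeMatrix N t).conjTranspose.mulVec v
  set X := (2 * lam / N : ℝ) ^ d * (lam * ((lam : ℝ) ^ (lam - 1) * C) ^ 2)
  have hX : 0 < X := by positivity
  have hq : 0 < 1 + 1 / (4 * √(β : ℝ)) := by positivity
  have h3 : 0 ≤ 1 - 1 / (β * √(β : ℝ) * 2 ^ β) := by
    have h4 : 1 ≤ √(β : ℝ) := Real.one_le_sqrt.2 (by exact_mod_cast hβ0)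
    have h5 : (1 : ℝ) ≤ β := by exact_mod_cast hβ0
    rw [sub_nonneg, div_le_one (by positivity)]
    exact one_le_mul_of_one_le_of_one_le (one_le_mul_of_one_le_of_one_le h5 h4)
      (one_le_pow₀ (by norm_num))
  -- Cauchy–Schwarz: `(1 - ε)²` is at most `‖A* v‖²` times the squared coefficient norm, which `h2`
  -- bounds.
  have h6 := (pow_le_pow_left₀ h3 h1 2).trans (sq_norm_sum_conj_mul_le _ _)
  have h7 := two_div_sqrt_pow_mul_le hd hβ he
  have h8 : 0 ≤ ∑ α, ‖w α‖ ^ 2 := by positivity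
  refine le_of_mul_le_mul_right ?_ (mul_pos hX hq)
  calc b ^ 2 * (X * (1 + 1 / (4 * √β))) = (2 / √β) ^ d * (1 + 1 / (4 * √β)) / 2.25 := by
        rw [← mul_assoc, hb]
        ring
    _ ≤ (1 - 1 / (β * √β * 2 ^ β)) ^ 2 := by
        rw [div_le_iff₀ (by norm_num)]
        linarith
    _ ≤ _ := h6.trans (mul_le_mul_of_nonneg_left h2 h8)

end

theorem theorem1 (β d N M L : ℕ) (hd : 1 ≤ d) (hM : 1 ≤ M)
    (hβ : d + 1 ≤ β) (hβ_even : Even β)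
    (t : Fin M → Fin d → ℝ) (Λ : Fin L → Finset (Fin d → ℝ))
    (hΩ : IsClusteredConfiguration N t Λ)
    (lam : ℕ) (hlam : lam = biggestClusterSize Λ)
    (C : ℝ) (hC : C = clusterComplexity N t)
    (hN : 2 * β ^ 2 * lam < N)
    (hρ : ENNReal.ofReal
        ((lam : ℝ) * (β : ℝ) *
          ((β : ℝ) ^ (1 / 2 : ℝ) * 2 ^ d * (2 ^ d - 1) * (lam : ℝ) ^ lam *
            (riemannZeta ((β : ℂ) - (d : ℂ) + 1)).re * C) ^ (1 / (β : ℝ)))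
      ≤ clusterSeparation N Λ) :
    (1.5 * (β : ℝ) ^ ((d : ℝ) / 4) * (lam : ℝ) ^ ((lam : ℝ) + (d : ℝ) / 2 - 1 / 2))⁻¹ *
        ((N : ℝ) ^ ((d : ℝ) / 2) / C)
      ≤ sigmaMin (vandermondeMatrix N t) := by
  have hβ0 : 0 < β := by omega
  have hβ' : (0 : ℝ) < β := by exact_mod_cast hβ0
  have hN0 : 0 < N := by omega
  obtain ⟨c, hc⟩ := hΩ.exists_label
  have hcard (l : Fin L) : (Finset.univ.filter fun k => c k = l).card ≤ lam :=
    hlam ▸ card_label_le hΩ.injective hc l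
  have hlam0 : 0 < lam := by
    refine lt_of_lt_of_le ?_ (hcard (c ⟨0, hM⟩))
    exact Finset.card_pos.2 ⟨⟨0, hM⟩, by simp⟩
  have hlam' : (1 : ℝ) ≤ lam := by exact_mod_cast hlam0
  have hC1 : 1 ≤ C := hC ▸ one_le_clusterComplexity hM hΩ.injective hN0
  have hpos : ∀ j k, j ≠ k → 0 < wrapNorm (t j - t k) := fun j k => hΩ.wrapNorm_sub_pos
  have hle : ∀ j k, c j = c k → wrapNorm (t j - t k) ≤ 1 / N := fun j k h =>
    (hΩ.isCluster (c k)).wrapNorm_sub_le (h ▸ hc j) (hc k)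
  set ζ := ∑' n : ℕ, 1 / (n : ℝ) ^ (β - d + 1) with hζ
  have hζ1 : 1 ≤ ζ := one_le_tsum_one_div_pow (by omega)
  have hzeta : (riemannZeta ((β : ℂ) - (d : ℂ) + 1)).re = ζ := by
    rw [hζ, ← riemannZeta_natCast_re (by omega)]
    push_cast [Nat.cast_sub (show d ≤ β by omega)]
    rfl
  have hβ1 : 1 ≤ √(β : ℝ) := Real.one_le_sqrt.2 (by exact_mod_cast hβ0)
  have h2d : (2 : ℝ) ≤ 2 ^ d := le_self_pow₀ (by norm_num) (by omega)
  set X := (β : ℝ) ^ (1 / 2 : ℝ) * 2 ^ d * (2 ^ d - 1) * (lam : ℝ) ^ lam *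
    (riemannZeta ((β : ℂ) - (d : ℂ) + 1)).re * C with hX
  set Y := √(β : ℝ) * (lam : ℝ) ^ lam * C
  have hXY : X = 2 ^ d * (2 ^ d - 1) * ζ * Y := by
    rw [hX, hzeta, ← Real.sqrt_eq_rpow]
    ring
  have hY1 : 1 ≤ Y := one_le_mul_of_one_le_of_one_le
    (one_le_mul_of_one_le_of_one_le hβ1 (one_le_pow₀ hlam')) hC1
  have hX1 : 1 ≤ X := by
    rw [hXY]
    refine one_le_mul_of_one_le_of_one_le (one_le_mul_of_one_le_of_one_le
      (one_le_mul_of_one_le_of_one_le ?_ ?_) hζ1) hY1 <;> linarith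
  -- The `β`-th power of the assumed separation is exactly what the packing bound needs; since `X ≥
  -- 1`, it also yields the plain separation `λβ`.
  set R := (lam : ℝ) * β * X ^ (1 / (β : ℝ)) with hR
  have hRβ : R ^ β = (lam * β) ^ β * X := by
    rw [hR, mul_pow, one_div, Real.rpow_inv_natCast_pow (by linarith) hβ0.ne']
  have hRle : lam * β ≤ R :=
    le_mul_of_one_le_right (by positivity) (Real.one_le_rpow hX1 (by positivity))
  have hR0 : 0 < R := lt_of_lt_of_le (by positivity) hRle
  have hsepR : ∀ j k, c j ≠ c k → R ≤ N * wrapNorm (t j - t k) := fun j k hjk =>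
    le_mul_wrapNorm_of_le_clusterSeparation hd hρ hjk (hc j) (hc k)
  have hsep : ∀ j k, c j ≠ c k → (lam * β : ℝ) ≤ N * wrapNorm (t j - t k) := fun j k hjk =>
    hRle.trans (hsepR j k hjk)
  have hrow := sum_pow_div_wrapNorm_le (t := t) hd hβ hN0 hcard hR0
    (b := lam * β) (by positivity) (lt_of_lt_of_le one_pos hY1) hsepR (by rw [hRβ, hXY])
  have hb := lower_bound_sq_mul (d := d) hβ0 hlam0 hN0 (lt_of_lt_of_le one_pos hC1)
  have : Nonempty (Fin M) := ⟨⟨0, hM⟩⟩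
  refine le_sigmaMin fun v hv => ?_
  rcases (show lam = 1 ∨ 2 ≤ lam by omega) with h1 | h2
  · subst h1
    -- With `λ = 1` every cluster is a single node, so there is nothing to interpolate within a
    -- cluster.
    have hinj : Function.Injective c := fun j k hjk =>
      Finset.card_le_one.1 (hcard (c k)) j (by simp [hjk]) k (by simp)
    exact sq_le_sum_of_isolated hd hβ hβ_even hN0 hinj hC1 hpos
      (fun j k hjk => by simpa using hsep j k hjk) hrow hb hv
  · refine sq_le_sum_of_clustered hd hβ hβ_even h2 ?_ hcard hC1 (fun k => ?_) hpos hle hsep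
      hrow hb hv
    -- `β ≥ 2` gives `8 ≤ 2β²`.
    · refine lt_of_le_of_lt (Nat.mul_le_mul_right lam ?_) hN
      nlinarith
    · rw [hC]
      refine prod_le_clusterComplexity hΩ.injective hN0 k _ fun k' hk' => ?_
      obtain ⟨h3, h4⟩ := (Finset.mem_filter.1 hk').2
      exact ⟨hpos k k' h4.symm, hle k k' h3.symm⟩
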